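/- A $k$-graph is a set of $k$-element subsets (edges) of a finite vertex set; a set of vertices is independent if it contains no edge, and $\alpha(H)$ is the maximum size of an independent set of $H$. The $r$-degree of an $r$-set $R$ of vertices of an $(r+1)$-graph is the number of edges containing $R$. A partial Steiner $(m,r+1,r)$-system is an $(r+1)$-graph on $m$ vertices in which every $r$-set has $r$-degree at most $1$. For an $(r+1)$-graph $S$ on $\{1,\dots,m\}$ and $d\ge 1$, the blowup $S(d)$ has as vertex set a disjoint union of sets $V_1,\dots,V_m$ of size $d$; its edges are all $(r+1)$-subsets of each $V_i$ and all sets $\{v_1,\dots,v_{r+1}\}$ with $v_j\in V_{x_j}$ for some edge $\{x_1,\dots,x_{r+1}\}$ of $S$. Let $H_{n,r+1,p}$ be the random $(r+1)$-graph on $n$ vertices in which every $(r+1)$-set is an edge independently with probability $p$. Logarithms are natural, and $f\ll g$ means $f(n)/g(n)\to 0$ as $n\to\infty$. Let $r\ge 2$. (1) If $S$ is a partial Steiner $(m,r+1,r)$-system with at least one edge and $d\ge 1$, then $S(d)$ has maximum $r$-degree exactly $d$ and $\alpha(S(d))=\min(r,d)\,\alpha(S)$. (2) There are $a_r,b_r>0$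 depending only on $r$ such that for every $m\ge r+1$ there is a partial Steiner $(m,r+1,r)$-system $S$ with $\alpha(S)\le a_r(m\log m)^{1/r}$ such that, for every $d\ge 1$, the blowup $S(d)$, which has $N=md$ vertices, has maximum $r$-degree $d$ and $\alpha(S(d))\le b_r\bigl(\frac Nd\log\frac Nd\bigr)^{1/r}$. (3) There is $b_r>0$ depending only on $r$ such that for all $d\ge 1$ and all $n>rd$ there is an $(r+1)$-graph $H$ on $n$ vertices with maximum $r$-degree $d$ and $\alpha(H)\le b_r\bigl(\frac nd\log\frac nd\bigr)^{1/r}$. (4) Let $d=d(n)$ be positive integers with $\log n\ll d$ and $d\le n-r$ for all large $n$, and let $p=d/(n-r)$. Then for every $\varepsilon>0$, with probability tending to $1$ as $n\to\infty$, $H=H_{n,r+1,p}$ satisfies: every $r$-set has $r$-degree between $(1-\varepsilon)d$ and $(1+\varepsilon)d$, and $\alpha(H)\le(1+\varepsilon)(r+1)!^{1/r}\bigl(\frac nd\log n\bigr)^{1/r}$. (5) Let $d=d(n)$ be positive integers with $\log n\ll d$ and $\log d\ll\log n$. Then for every $\varepsilon>0$, with probability tending to $1$, $H=H_{n,r+1,p}$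 with $p=d/(n-r)$ has all $r$-degrees between $(1-\varepsilon)d$ and $(1+\varepsilon)d$ and $\alpha(H)\le(1+\varepsilon)(r+1)!^{1/r}\bigl(\frac nd\log\frac nd\bigr)^{1/r}$. Moreover, for all sufficiently large $n$ there is an $(r+1)$-graph $H$ on $n$ vertices with maximum $r$-degree exactly $d$ and $\alpha(H)\le(1+\varepsilon)(r+1)!^{1/r}\bigl(\frac nd\log\frac nd\bigr)^{1/r}$. (6) Call a real number $c$ a lower-bound constant for $r$ if, for all sufficiently large $n$, every $(r+1)$-graph $H$ on $n$ vertices with maximum $r$-degree $d<n/(\log n)^{3r^2}$ satisfies $\alpha(H)\ge c\bigl(\frac nd\log\frac nd\bigr)^{1/r}$ (the right-hand side being read as $0$ if $d=0$). Every lower-bound constant $c$ for $r$ satisfies $c\le (r+1)!^{1/r}$. Finally, $(r+1)!^{1/r}\sim r/e$ as $r\to\infty$; consequently, if $c_r$ is a lower-bound constant for $r$ for each $r\ge2$, then for every $\varepsilon>0$ we have $c_r\le(1+\varepsilon)\,r/e$ for all sufficiently large $r$. In this sense a lower bound with $c_r\sim r/e$ is asymptotically sharp for large $r$. -/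

import Mathlib

open Filter Topology Asymptotics

/-- A `k`-graph with vertex set the (finite) type `V`: a set of `k`-element subsets of `V`. -/
structure KGraph (k : ℕ) (V : Type*) where
  edges : Finset (Finset V)
  card_edge : ∀ e ∈ edges, e.card = k

namespace KGraph

variable {k r : ℕ} {V : Type*}

/-- A set of vertices is independent if it contains no edge. -/
def IsIndep (H : KGraph k V) (Z : Finset V) : Prop :=
  ∀ e ∈ H.edges, ¬ e ⊆ Z

open Classical in
/-- The independence number: the maximum size of an independent set. -/
noncomputable def indepNum [Fintype V] (H : KGraph k V) : ℕ :=
  ((Finset.univ : Finset (Finset V)).filter H.IsIndep).sup Finset.card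

/-- The degree of a set `R` of vertices: the number of edges containing `R`. -/
def degree [DecidableEq V] (H : KGraph k V) (R : Finset V) : ℕ :=
  (H.edges.filter (fun e => R ⊆ e)).card

/-- The maximum `r`-degree of an `(r+1)`-graph: the maximum number of edges containing a common
`r`-set of vertices. -/
def maxDegree [Fintype V] [DecidableEq V] (H : KGraph (r + 1) V) : ℕ :=
  ((Finset.univ : Finset V).powersetCard r).sup H.degree

/-- `H` is a partial Steiner `(n, r+1, r)`-system (where `n = |V|`): each `r`-set of vertices is
contained in at most one edge. -/
def IsPartialSteiner [DecidableEq V] (H : KGraph (r + 1) V) : Prop :=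
  ∀ R : Finset V, R.card = r → H.degree R ≤ 1

open Classical in
/-- The `d`-fold blowup of an `(r+1)`-graph `S`. Each vertex `i` is replaced by the set
`V_i = {i} × Fin d` of size `d`; the edges are all `(r+1)`-subsets of each `V_i`, together with all
sets `{v_1, …, v_{r+1}}` with `v_j ∈ V_{x_j}` for some edge `{x_1, …, x_{r+1}}` of `S`.
(An `(r+1)`-set whose projection is an edge of `S` meets each of the `r+1` corresponding parts in
exactly one vertex.) -/
noncomputable def blowup [Fintype V] (S : KGraph (r + 1) V) (d : ℕ) :
    KGraph (r + 1) (V × Fin d) where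
  edges := ((Finset.univ : Finset (V × Fin d)).powersetCard (r + 1)).filter
    (fun e => (∃ i : V, ∀ v ∈ e, v.1 = i) ∨ e.image Prod.fst ∈ S.edges)
  card_edge := fun _ he => (Finset.mem_powersetCard.1 (Finset.mem_filter.1 he).1).2

open Classical in
/-- The `k`-graph whose edges are the `k`-element members of the family `E`. -/
noncomputable def ofSet [Fintype V] (k : ℕ) (E : Set (Finset V)) : KGraph k V where
  edges := (Finset.univ : Finset (Finset V)).filter (fun e => e.card = k ∧ e ∈ E)
  card_edge := fun _ he => (Finset.mem_filter.1 he).2.1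

/-- The probability of the event `A` for the random `k`-graph `H_{n,k,p}` on `n` vertices, each
`k`-set of vertices being an edge independently with probability `p`. -/
noncomputable def randomProb (n k : ℕ) (p : unitInterval) (A : KGraph k (Fin n) → Prop) : ℝ :=
  (ProbabilityTheory.setBernoulli {e : Finset (Fin n) | e.card = k} p).real {E | A (ofSet k E)}

/-- The edge probability `d / (n - r)`, which makes `d` the expected degree of each `r`-set.
It is truncated to `[0, 1]`; the truncation has no effect when `d + r ≤ n` and `r < n`. -/
noncomputable def edgeProb (n r d : ℕ) : unitInterval :=
  Set.projIcc (0 : ℝ) 1 zero_le_one ((d : ℝ) / ((n : ℝ) - (r : ℝ)))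

/-- `c` is a valid constant in the lower bound `α(H) ≥ c ((n/d) log (n/d))^{1/r}` for all
`(r+1)`-graphs `H` on `n` vertices, `n` large, with maximum `r`-degree `d < n / (log n)^{3 r^2}`. -/
def IsLowerBoundConstant (r : ℕ) (c : ℝ) : Prop :=
  ∀ᶠ n : ℕ in atTop, ∀ H : KGraph (r + 1) (Fin n),
    (H.maxDegree : ℝ) < (n : ℝ) / Real.log n ^ (3 * r ^ 2) →
    c * ((n : ℝ) / H.maxDegree * Real.log ((n : ℝ) / H.maxDegree)) ^ (1 / (r : ℝ))
      ≤ (H.indepNum : ℝ)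

end KGraph

/-! The deterministic examples are blowups. In `S(d)` an `r`-set inside one part extends to an edge
only within that part. An `r`-set meeting `r` parts extends only through the unique edge of `S`
containing its projection, hence only into one further part. So degrees are at most `d`. An
independent set of `S(d)` projects to an independent set of `S` and has at most `min(r, d)` points
over each vertex, which gives `α(S(d)) = min(r, d) α(S)`. For other numbers of vertices one part is
cut short.

It remains to find partial Steiner systems with `α = O((m log m)^{1/r})`. Take a random
`(r+1)`-graph with `p = 1/(32(r+1)m)` and apply the local lemma to two kinds of bad events: two
edges share `r` vertices, or a `k`-set contains no edge. An `(r+1)`-set is in conflict with only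
`O(m)` others. With weights of order `p²` for pairs, the conflicts therefore cost a factor `1 - p/4`
per possible edge of the event considered, and the probability `(1-p)^{C(k,r+1)}` of an independent
`k`-set can pay for it. The `k`-sets are so unlikely that all of them may count as neighbours of
each other.

The constant `(r+1)!^{1/r}` comes from the random hypergraph. Chernoff's bound and a union bound
over at most `n^r` sets control the degrees, since `d ≫ log n`. The expected number of independent
`k`-sets is at most `n^k exp(-p C(k,r+1))`, and `k log n` balances `(d/n) k^{r+1}/(r+1)!` at `k =
((r+1)! (n/d) log n)^{1/r}`. If `log d ≪ log n`, then `log n` may be replaced by `log (n/d)`.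
Starting with expected degree slightly below `d` and adding edges makes the maximum degree exactly
`d`. The choice `d = ⌈(log n)²⌉` bounds every lower-bound constant, and Stirling's formula gives
`r/e`. -/

section RandomSubset

/-! ### Random subsets of a finite set: independence, Chernoff's bound, the local lemma -/

variable {α : Type*}

/-- The expectation of `f G` when `G` is the random subset of `U` that contains each element
independently with probability `p`. -/
noncomputable def bernExp (U : Finset α) (p : ℝ) (f : Finset α → ℝ) : ℝ :=
  ∑ G ∈ U.powerset, p ^ G.card * (1 - p) ^ (U.card - G.card) * f G

/-- The probability that the `p`-random subset of `U` lies in `A`. -/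
noncomputable def bernProb (U : Finset α) (p : ℝ) (A : Set (Finset α)) : ℝ :=
  bernExp U p (A.indicator 1)

variable {U s t : Finset α} {p : ℝ}

theorem bernExp_mono (h0 : 0 ≤ p) (h1 : p ≤ 1) {f g : Finset α → ℝ}
    (h : ∀ G ⊆ U, f G ≤ g G) : bernExp U p f ≤ bernExp U p g := by
  have : 0 ≤ 1 - p := by linarith
  refine Finset.sum_le_sum fun G hG => ?_
  exact mul_le_mul_of_nonneg_left (h G (Finset.mem_powerset.1 hG)) (by positivity)

theorem bernExp_congr {f g : Finset α → ℝ} (h : ∀ G ⊆ U, f G = g G) :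
    bernExp U p f = bernExp U p g :=
  Finset.sum_congr rfl fun G hG => by rw [h G (Finset.mem_powerset.1 hG)]

/-- The binomial generating function: `c = 1` gives total mass one, `c = 0` the probability of being
empty, and `c = exp u` the moments in Chernoff's bound. -/
theorem bernExp_pow_card (c : ℝ) :
    bernExp U p (fun G => c ^ G.card) = (p * c + (1 - p)) ^ U.card := by
  rw [← Finset.sum_pow_mul_eq_add_pow]
  refine Finset.sum_congr rfl fun G _ => ?_
  rw [mul_pow]; ring

theorem bernExp_one : bernExp U p (fun _ => 1) = 1 := by
  simpa using bernExp_pow_card (U := U) (p := p) 1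

theorem bernExp_add (f g : Finset α → ℝ) :
    bernExp U p (fun G => f G + g G) = bernExp U p f + bernExp U p g := by
  simp [bernExp, mul_add, Finset.sum_add_distrib]

theorem bernExp_sub (f g : Finset α → ℝ) :
    bernExp U p (fun G => f G - g G) = bernExp U p f - bernExp U p g := by
  simp [bernExp, mul_sub, Finset.sum_sub_distrib]

theorem bernExp_const_mul (c : ℝ) (f : Finset α → ℝ) :
    bernExp U p (fun G => c * f G) = c * bernExp U p f := by
  rw [bernExp, bernExp, Finset.mul_sum]
  exact Finset.sum_congr rfl fun G _ => by ring

theorem bernExp_sum {ι : Type*} (I : Finset ι) (f : ι → Finset α → ℝ) :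
    bernExp U p (fun G => ∑ i ∈ I, f i G) = ∑ i ∈ I, bernExp U p (f i) := by
  simp only [bernExp, Finset.mul_sum]
  exact Finset.sum_comm

theorem bernProb_nonneg (h0 : 0 ≤ p) (h1 : p ≤ 1) (A : Set (Finset α)) : 0 ≤ bernProb U p A := by
  have : 0 ≤ 1 - p := by linarith
  refine Finset.sum_nonneg fun G _ => mul_nonneg (by positivity) ?_
  exact Set.indicator_nonneg (fun _ _ => zero_le_one) _

theorem bernProb_mono (h0 : 0 ≤ p) (h1 : p ≤ 1) {A B : Set (Finset α)}
    (h : ∀ G ⊆ U, G ∈ A → G ∈ B) : bernProb U p A ≤ bernProb U p B := by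
  refine bernExp_mono h0 h1 fun G hG => ?_
  by_cases hA : G ∈ A
  · simp [hA, h G hG hA]
  · rw [Set.indicator_of_notMem hA]
    exact Set.indicator_nonneg (fun _ _ => zero_le_one) _

theorem bernProb_univ : bernProb U p Set.univ = 1 := by
  rw [bernProb, Set.indicator_univ]
  exact bernExp_one

theorem bernProb_compl (A : Set (Finset α)) : bernProb U p Aᶜ = 1 - bernProb U p A := by
  rw [bernProb, bernProb, ← bernExp_one (U := U) (p := p), ← bernExp_sub]
  refine bernExp_congr fun G _ => ?_
  by_cases h : G ∈ A <;> simp [h]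

theorem bernProb_union_le (h0 : 0 ≤ p) (h1 : p ≤ 1) (A B : Set (Finset α)) :
    bernProb U p (A ∪ B) ≤ bernProb U p A + bernProb U p B := by
  rw [bernProb, bernProb, bernProb, ← bernExp_add]
  refine bernExp_mono h0 h1 fun G _ => ?_
  by_cases hA : G ∈ A <;> by_cases hB : G ∈ B <;> simp [hA, hB]

theorem bernProb_exists_le (h0 : 0 ≤ p) (h1 : p ≤ 1) {ι : Type*} (I : Finset ι)
    (A : ι → Set (Finset α)) :
    bernProb U p {G | ∃ i ∈ I, G ∈ A i} ≤ ∑ i ∈ I, bernProb U p (A i) := by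
  simp only [bernProb]
  rw [← bernExp_sum]
  refine bernExp_mono h0 h1 fun G _ => ?_
  have hnn : ∀ i ∈ I, 0 ≤ (A i).indicator (1 : Finset α → ℝ) G :=
    fun i _ => Set.indicator_nonneg (fun _ _ => zero_le_one) _
  by_cases h : ∃ i ∈ I, G ∈ A i
  · obtain ⟨i, hi, hG⟩ := h
    calc _ ≤ (1 : ℝ) := Set.indicator_le' (fun _ _ => le_rfl) (fun _ _ => zero_le_one) G
      _ = (A i).indicator (1 : Finset α → ℝ) G := by simp [hG]
      _ ≤ _ := Finset.single_le_sum hnn hi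
  · rw [Set.indicator_of_notMem (by simpa using h)]
    exact Finset.sum_nonneg hnn

variable [DecidableEq α]

/-- Expectations of functions of disjoint parts of the random set multiply. -/
theorem bernExp_union_mul (hst : Disjoint s t) (f g : Finset α → ℝ) :
    bernExp (s ∪ t) p (fun G => f (G ∩ s) * g (G ∩ t)) = bernExp s p f * bernExp t p g := by
  rw [bernExp, bernExp, bernExp, Finset.sum_mul_sum, ← Finset.sum_product']
  refine Finset.sum_bij' (fun G _ => (G ∩ s, G ∩ t)) (fun x _ => x.1 ∪ x.2) ?_ ?_ ?_ ?_ ?_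
  · intro G _
    simp [Finset.inter_subset_right]
  · intro x hx
    simp only [Finset.mem_product, Finset.mem_powerset] at hx ⊢
    exact Finset.union_subset_union hx.1 hx.2
  · intro G hG
    simp only [Finset.mem_powerset] at hG
    simp only [← Finset.inter_union_distrib_left]
    exact Finset.inter_eq_left.2 hG
  · intro x hx
    simp only [Finset.mem_product, Finset.mem_powerset] at hx
    have h1 : x.2 ∩ s = ∅ := Finset.disjoint_iff_inter_eq_empty.1 (hst.symm.mono_left hx.2)
    have h2 : x.1 ∩ t = ∅ := Finset.disjoint_iff_inter_eq_empty.1 (hst.mono_left hx.1)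
    ext1
    · simp [Finset.union_inter_distrib_right, h1, Finset.inter_eq_left.2 hx.1]
    · simp [Finset.union_inter_distrib_right, h2, Finset.inter_eq_left.2 hx.2]
  · intro G hG
    simp only [Finset.mem_powerset] at hG
    have hc : G.card = (G ∩ s).card + (G ∩ t).card := by
      rw [← Finset.card_union_of_disjoint
        (hst.mono Finset.inter_subset_right Finset.inter_subset_right),
        ← Finset.inter_union_distrib_left, Finset.inter_eq_left.2 hG]
    have h1 := Finset.card_le_card (Finset.inter_subset_right (s₁ := G) (s₂ := s))
    have h2 := Finset.card_le_card (Finset.inter_subset_right (s₁ := G) (s₂ := t))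
    have hu : (s ∪ t).card - G.card = (s.card - (G ∩ s).card) + (t.card - (G ∩ t).card) := by
      rw [Finset.card_union_of_disjoint hst]; omega
    rw [hu, hc, pow_add, pow_add]; ring

/-- Independence in the form used by the local lemma. As `t` lies in `U \ s`, splitting `U` into `s`
and `U \ s` separates the two functions. -/
theorem bernExp_mul_of_disjoint (hs : s ⊆ U) (ht : t ⊆ U) (hst : Disjoint s t)
    {f g : Finset α → ℝ} (hf : ∀ G ⊆ U, f G = f (G ∩ s)) (hg : ∀ G ⊆ U, g G = g (G ∩ t)) :
    bernExp U p (fun G => f G * g G) = bernExp U p f * bernExp U p g := by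
  have hd : Disjoint s (U \ s) := Finset.disjoint_sdiff
  have hU : s ∪ U \ s = U := Finset.union_sdiff_of_subset hs
  have hg' : ∀ G ⊆ U, g G = g (G ∩ (U \ s)) := by
    intro G hG
    rw [hg G hG, hg (G ∩ (U \ s)) (Finset.inter_subset_left.trans hG), Finset.inter_assoc]
    congr 2
    exact (Finset.inter_eq_right.2 fun x hx => Finset.mem_sdiff.2
      ⟨ht hx, Finset.disjoint_right.1 hst hx⟩).symm
  have key : ∀ f g : Finset α → ℝ, bernExp U p (fun G => f (G ∩ s) * g (G ∩ (U \ s)))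
      = bernExp s p f * bernExp (U \ s) p g := by
    intro f g
    have := bernExp_union_mul (p := p) hd f g
    rwa [hU] at this
  have e1 : bernExp U p f = bernExp s p f := by
    have := key f (fun _ => 1)
    rw [bernExp_one, mul_one] at this
    rw [← this]
    exact bernExp_congr fun G hG => by rw [hf G hG, mul_one]
  have e2 : bernExp U p g = bernExp (U \ s) p g := by
    have := key (fun _ => 1) g
    rw [bernExp_one, one_mul] at this
    rw [← this]
    exact bernExp_congr fun G hG => by rw [hg' G hG, one_mul]
  rw [e1, e2, ← key]
  exact bernExp_congr fun G hG => by rw [hf G hG, hg' G hG]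

/-- The random subset of `U` restricted to `s ⊆ U` is the random subset of `s`. -/
theorem bernExp_inter (hs : s ⊆ U) (f : Finset α → ℝ) :
    bernExp U p (fun G => f (G ∩ s)) = bernExp s p f := by
  have := bernExp_union_mul (p := p) (Finset.disjoint_sdiff (s := s) (t := U)) f (fun _ => 1)
  rw [bernExp_one, mul_one, Finset.union_sdiff_of_subset hs] at this
  simpa using this

theorem bernExp_pow_card_inter (hs : s ⊆ U) (c : ℝ) :
    bernExp U p (fun G => c ^ (G ∩ s).card) = (p * c + (1 - p)) ^ s.card := by
  rw [bernExp_inter hs (fun G => c ^ G.card), bernExp_pow_card]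

theorem bernProb_disjoint (hs : s ⊆ U) :
    bernProb U p {G | Disjoint G s} = (1 - p) ^ s.card := by
  have := bernExp_pow_card_inter (p := p) hs 0
  rw [mul_zero, zero_add] at this
  rw [← this]
  refine bernExp_congr fun G _ => ?_
  by_cases h : Disjoint G s
  · simp [h, Finset.disjoint_iff_inter_eq_empty.1 h]
  · rw [Set.indicator_of_notMem (by simpa using h), zero_pow]
    rwa [Ne, Finset.card_eq_zero, ← Finset.disjoint_iff_inter_eq_empty]

theorem bernProb_subset (hs : s ⊆ U) : bernProb U p {G | s ⊆ G} = p ^ s.card := by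
  classical
  have h1 : bernProb U p {G | s ⊆ G} = bernExp s p (Set.indicator {G | s ⊆ G} 1) := by
    rw [← bernExp_inter hs]
    refine bernExp_congr fun G _ => ?_
    simp [Set.indicator_apply, Finset.subset_inter_iff]
  rw [h1, bernExp, Finset.sum_eq_single s]
  · simp
  · intro G hG hne
    rw [Set.indicator_of_notMem, mul_zero]
    exact fun h => hne (Finset.Subset.antisymm (Finset.mem_powerset.1 hG) h)
  · simp

/-- Chernoff's bound for both tails. -/
theorem bernProb_chernoff (h0 : 0 ≤ p) (h1 : p ≤ 1) (hs : s ⊆ U) {δ : ℝ} (hδ : 0 < δ)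
    (hδ1 : δ ≤ 1) :
    bernProb U p {G | δ * (p * s.card) < |((G ∩ s).card : ℝ) - p * s.card|}
      ≤ 2 * Real.exp (-(δ ^ 2 / 4 * (p * s.card))) := by
  set d : ℝ := p * s.card with hd
  have hd0 : 0 ≤ d := by positivity
  -- Markov's inequality for `exp (u X)`; the signs `u = ±δ/2` give the two tails. The exponent is
  -- at most `d u² - δ |u| d = -δ² d / 4`, by `exp u - 1 - u ≤ u²`.
  have key : ∀ u : ℝ, |u| = δ / 2 →
      bernProb U p {G | δ * (|u| * d) ≤ u * (((G ∩ s).card : ℝ) - d)}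
        ≤ Real.exp (-(δ ^ 2 / 4 * d)) := by
    intro u hu
    have hE : bernExp U p (fun G => Real.exp (-(u * d + δ * |u| * d)) *
        Real.exp u ^ (G ∩ s).card) ≤ Real.exp (-(δ ^ 2 / 4 * d)) := by
      rw [bernExp_const_mul, bernExp_pow_card_inter hs]
      have h2 : p * Real.exp u + (1 - p) ≤ Real.exp (p * (Real.exp u - 1)) := by
        have := Real.add_one_le_exp (p * (Real.exp u - 1)); linarith
      have h3 : 0 ≤ p * Real.exp u + (1 - p) := by
        have := Real.exp_pos u; nlinarith
      have h4 : (p * Real.exp u + (1 - p)) ^ s.card ≤ Real.exp (d * (Real.exp u - 1)) := by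
        refine (pow_le_pow_left₀ h3 h2 _).trans ?_
        rw [← Real.exp_nat_mul]
        refine le_of_eq (congrArg _ ?_)
        rw [hd]; ring
      refine (mul_le_mul_of_nonneg_left h4 (Real.exp_pos _).le).trans ?_
      rw [← Real.exp_add, Real.exp_le_exp]
      have h5 : Real.exp u - 1 - u ≤ u ^ 2 :=
        (le_abs_self _).trans (Real.abs_exp_sub_one_sub_id_le (by rw [hu]; linarith))
      have h6 : u ^ 2 = δ ^ 2 / 4 := by rw [← sq_abs, hu]; ring
      rw [hu]
      nlinarith
    refine le_trans (bernExp_mono h0 h1 fun G _ => ?_) hE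
    rw [Set.indicator_apply]
    split_ifs with h
    · rw [← Real.exp_nat_mul, ← Real.exp_add, Pi.one_apply]
      apply Real.one_le_exp
      simp only [Set.mem_ofPred_eq] at h
      nlinarith
    · positivity
  have hup := key (δ / 2) (abs_of_pos (by linarith))
  have hlo := key (-(δ / 2)) (by rw [abs_neg]; exact abs_of_pos (by linarith))
  rw [two_mul]
  refine le_trans ?_ (add_le_add hup hlo)
  refine le_trans (bernProb_mono h0 h1 ?_) (bernProb_union_le h0 h1 _ _)
  intro G _ hG
  simp only [Set.mem_ofPred_eq, Set.mem_union, abs_neg] at hG ⊢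
  rw [abs_of_pos (by linarith : 0 < δ / 2)]
  rcases lt_abs.1 hG with h | h
  · left; nlinarith
  · right; nlinarith

/-- The **Lovász local lemma** for events `A i` determined by the intersection of a random set with
`s i`. -/
theorem exists_avoiding_of_local_lemma (h0 : 0 ≤ p) (h1 : p ≤ 1) {ι : Type*} [DecidableEq ι]
    (I : Finset ι) (A : ι → Set (Finset α)) (S : ι → Finset α) (Γ : ι → Finset ι) (x : ι → ℝ)
    (hSU : ∀ i ∈ I, S i ⊆ U)
    (hS : ∀ i ∈ I, ∀ G ⊆ U, G ∈ A i ↔ G ∩ S i ∈ A i)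
    (hΓ : ∀ i ∈ I, ∀ j ∈ I, j ∉ Γ i → Disjoint (S i) (S j))
    (hx0 : ∀ i, 0 ≤ x i) (hx1 : ∀ i, x i < 1)
    (hP : ∀ i ∈ I, bernProb U p (A i) ≤ x i * ∏ j ∈ Γ i, (1 - x j)) :
    ∃ G ⊆ U, ∀ i ∈ I, G ∉ A i := by
  classical
  set F : Finset ι → ℝ := fun T => bernProb U p {G | ∀ j ∈ T, G ∉ A j} with hF
  have hF0 : ∀ T, 0 ≤ F T := fun T => bernProb_nonneg h0 h1 _
  have hins : ∀ i T, F (insert i T) = F T - bernProb U p {G | G ∈ A i ∧ ∀ j ∈ T, G ∉ A j} := by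
    intro i T
    simp only [hF, bernProb]
    rw [← bernExp_sub]
    refine bernExp_congr fun G _ => ?_
    by_cases hi : G ∈ A i <;> by_cases hT : ∀ j ∈ T, G ∉ A j <;>
      simp [Set.indicator_apply, hi, hT]
  have hindep : ∀ i ∈ I, ∀ T ⊆ I, (∀ j ∈ T, j ∉ Γ i) →
      bernProb U p {G | G ∈ A i ∧ ∀ j ∈ T, G ∉ A j} = bernProb U p (A i) * F T := by
    intro i hi T hT hTΓ
    simp only [hF, bernProb]
    rw [← bernExp_mul_of_disjoint (hSU i hi) (t := T.biUnion S)]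
    · refine bernExp_congr fun G _ => ?_
      by_cases hi : G ∈ A i <;> by_cases hT : ∀ j ∈ T, G ∉ A j <;>
        simp [Set.indicator_apply, hi, hT]
    · exact Finset.biUnion_subset.2 fun j hj => hSU j (hT hj)
    · exact (Finset.disjoint_biUnion_right _ _ _).2 fun j hj => hΓ i hi j (hT hj) (hTΓ j hj)
    · intro G hG
      have := hS i hi G hG
      by_cases h : G ∈ A i
      · simp [h, this.1 h]
      · rw [Set.indicator_of_notMem h, Set.indicator_of_notMem (fun h' => h (this.2 h'))]
    · intro G hG
      have : ∀ j ∈ T, (G ∈ A j ↔ G ∩ T.biUnion S ∈ A j) := by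
        intro j hj
        rw [hS j (hT hj) G hG, hS j (hT hj) (G ∩ T.biUnion S) (Finset.inter_subset_left.trans hG),
          Finset.inter_assoc, Finset.inter_eq_right.2 (Finset.subset_biUnion_of_mem S hj)]
      have h2 : (∀ j ∈ T, G ∉ A j) ↔ ∀ j ∈ T, G ∩ T.biUnion S ∉ A j :=
        forall₂_congr fun j hj => not_congr (this j hj)
      simp only [Set.indicator_apply, Set.mem_ofPred_eq, h2, Pi.one_apply]
  -- The usual bound `x i` on the probability of `A i` given that no event of `T` occurs, multiplied
  -- out so that no conditioning on a null event can arise. Strong induction on the size of `T`.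
  have key : ∀ n : ℕ, ∀ T ⊆ I, T.card ≤ n → ∀ i ∈ I,
      bernProb U p {G | G ∈ A i ∧ ∀ j ∈ T, G ∉ A j} ≤ x i * F T := by
    intro n
    induction n using Nat.strong_induction_on with
    | _ n ih =>
    intro T hT hn i hi
    set T₁ := T.filter (· ∈ Γ i) with hT₁
    set T₂ := T.filter (· ∉ Γ i) with hT₂
    have h₂ : T₂ ⊆ T := Finset.filter_subset _ _
    -- The neighbours of `i` are added to `T₂` one at a time. Each costs a factor `1 - x j` by the
    -- induction hypothesis, as the set before the addition is strictly smaller than `T`.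
    have hchain : ∀ W ⊆ T₁, (∏ j ∈ W, (1 - x j)) * F T₂ ≤ F (W ∪ T₂) := by
      intro W
      induction W using Finset.induction_on with
      | empty => intro _; simp
      | insert a W ha ihW =>
        intro hW
        have haT : a ∈ T₁ := hW (Finset.mem_insert_self _ _)
        have hWT : W ⊆ T₁ := (Finset.subset_insert _ _).trans hW
        have haN : a ∉ W ∪ T₂ := by
          simp only [Finset.mem_union, not_or]
          refine ⟨ha, fun h => ?_⟩
          exact (Finset.mem_filter.1 h).2 (Finset.mem_filter.1 haT).2
        have hsub : W ∪ T₂ ⊆ T :=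
          Finset.union_subset (hWT.trans (Finset.filter_subset _ _)) h₂
        have haT' : a ∈ T := (Finset.mem_filter.1 haT).1
        have hlt : (W ∪ T₂).card < n :=
          lt_of_lt_of_le (Finset.card_lt_card ⟨hsub, fun h => haN (h haT')⟩) hn
        have := ih _ hlt (W ∪ T₂) (hsub.trans hT) le_rfl a (hT haT')
        rw [Finset.prod_insert ha, Finset.insert_union, hins]
        have h3 := mul_le_mul_of_nonneg_left (ihW hWT) (sub_nonneg.2 (hx1 a).le)
        nlinarith
    have hT12 : T₁ ∪ T₂ = T := Finset.filter_union_filter_not_eq _ _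
    have hprod : ∏ j ∈ Γ i, (1 - x j) ≤ ∏ j ∈ T₁, (1 - x j) := by
      refine Finset.prod_le_prod_of_subset_of_le_one (fun j hj => (Finset.mem_filter.1 hj).2)
        (fun j _ => sub_nonneg.2 (hx1 j).le) (fun j _ _ => by linarith [hx0 j])
    calc bernProb U p {G | G ∈ A i ∧ ∀ j ∈ T, G ∉ A j}
        ≤ bernProb U p {G | G ∈ A i ∧ ∀ j ∈ T₂, G ∉ A j} :=
          bernProb_mono h0 h1 fun G _ hG => ⟨hG.1, fun j hj => hG.2 j (h₂ hj)⟩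
      _ = bernProb U p (A i) * F T₂ :=
          hindep i hi T₂ (h₂.trans hT) fun j hj => (Finset.mem_filter.1 hj).2
      _ ≤ x i * (∏ j ∈ T₁, (1 - x j)) * F T₂ :=
          mul_le_mul_of_nonneg_right
            ((hP i hi).trans (mul_le_mul_of_nonneg_left hprod (hx0 i))) (hF0 _)
      _ ≤ x i * F T := by
          rw [mul_assoc]
          refine mul_le_mul_of_nonneg_left ?_ (hx0 i)
          rw [← hT12]
          exact hchain T₁ subset_rfl
  have hpos : ∀ T ⊆ I, 0 < F T := by
    intro T
    induction T using Finset.induction_on with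
    | empty => intro _; simp [hF, bernProb_univ]
    | insert a T ha ih =>
      intro hT
      have hT' := (Finset.subset_insert a T).trans hT
      have := key _ T hT' le_rfl a (hT (Finset.mem_insert_self _ _))
      rw [hins]
      nlinarith [ih hT', hx1 a]
  by_contra! hcon
  have : F I ≤ bernProb U p (∅ : Set (Finset α)) := bernProb_mono h0 h1 fun G hG hA => by
    obtain ⟨i, hi, hGi⟩ := hcon G hG
    exact (hA i hi hGi).elim
  have h3 : bernProb U p (∅ : Set (Finset α)) = 0 := by simp [bernProb, bernExp]
  linarith [hpos I subset_rfl]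

end RandomSubset

/-! ### The law of the random hypergraph -/

namespace KGraph

open Classical in
/-- The law of the random `k`-graph as an explicit finite sum. -/
theorem randomProb_eq_bernProb (n k : ℕ) (p : unitInterval) (A : KGraph k (Fin n) → Prop) :
    randomProb n k p A = bernProb ((Finset.univ : Finset (Fin n)).powersetCard k) p
      {G | A (ofSet k (G : Set (Finset (Fin n))))} := by
  set U := (Finset.univ : Finset (Fin n)).powersetCard k with hU
  have hu : {e : Finset (Fin n) | e.card = k} = (U : Set (Finset (Fin n))) := by
    ext e; simp [hU]
  rw [randomProb, hu, MeasureTheory.measureReal_def,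
    ProbabilityTheory.setBernoulli_apply_eq_apply_subsets, ← MeasureTheory.measureReal_def]
  -- Once restricted to subsets of the finite set `U`, the event is a finite disjoint union of
  -- singletons.
  have hS : {s : Set (Finset (Fin n)) | s ∈ {E | A (ofSet k E)} ∧ s ⊆ (U : Set (Finset (Fin n)))}
      = ⋃ G : Finset (Finset (Fin n)), ⋃ _ : G ∈ U.powerset.filter
          (fun G : Finset (Finset (Fin n)) => A (ofSet k (G : Set (Finset (Fin n))))),
        {(G : Set (Finset (Fin n)))} := by
    ext s
    simp only [Set.mem_ofPred_eq, Set.mem_iUnion, Finset.mem_filter, Finset.mem_powerset,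
      Set.mem_singleton_iff, exists_prop]
    constructor
    · rintro ⟨h1, h2⟩
      have hs : (((Set.toFinite s).toFinset : Finset _) : Set (Finset (Fin n))) = s := by simp
      refine ⟨(Set.toFinite s).toFinset, ⟨?_, by rwa [hs]⟩, hs.symm⟩
      rw [← Finset.coe_subset, hs]
      exact h2
    · rintro ⟨G, ⟨h1, h2⟩, rfl⟩
      exact ⟨h2, Finset.coe_subset.2 h1⟩
  rw [hS, MeasureTheory.measureReal_biUnion_finset]
  · rw [bernProb, bernExp, Finset.sum_filter]
    refine Finset.sum_congr rfl fun G hG => ?_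
    rw [Finset.mem_powerset] at hG
    rw [ProbabilityTheory.setBernoulli_real_singleton _ (Finset.coe_subset.2 hG) U.finite_toSet,
      ← Finset.coe_sdiff, Set.ncard_coe_finset, Set.ncard_coe_finset,
      Finset.card_sdiff_of_subset hG]
    simp [Set.indicator_apply]
  · intro G _ G' _ hne
    simpa using hne
  · intro G _
    exact MeasurableSet.singleton _

end KGraph

/-! ### Independence numbers, degrees and induced hypergraphs -/

namespace KGraph

section General

variable {k r d : ℕ} {V W : Type*} [DecidableEq V]

theorem card_le_degree {H : KGraph k V} {R X : Finset V} (hX : ∀ v ∈ X, v ∉ R)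
    (h : ∀ v ∈ X, insert v R ∈ H.edges) : X.card ≤ H.degree R := by
  refine Finset.card_le_card_of_injOn (fun v => insert v R) (fun v hv => ?_) ?_
  · exact Finset.mem_coe.2 (Finset.mem_filter.2 ⟨h v hv, Finset.subset_insert _ _⟩)
  · intro v hv w hw hvw
    have : v ∈ insert w R := by
      rw [← show insert v R = insert w R from hvw]; exact Finset.mem_insert_self _ _
    exact (Finset.mem_insert.1 this).resolve_right (hX v hv)

/-- The hypergraph induced along an embedding of vertex sets. -/
def comap [Fintype W] [DecidableEq W] (H : KGraph k V) (f : W ↪ V) : KGraph k W where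
  edges := Finset.univ.filter fun e => e.map f ∈ H.edges
  card_edge e he := by
    rw [← H.card_edge _ (Finset.mem_filter.1 he).2, Finset.card_map]

theorem mem_comap_edges [Fintype W] [DecidableEq W] {H : KGraph k V} {f : W ↪ V} {e : Finset W} :
    e ∈ (H.comap f).edges ↔ e.map f ∈ H.edges := by
  simp [comap]

theorem IsPartialSteiner.eq_of_subset {S : KGraph (r + 1) V} (hS : S.IsPartialSteiner)
    {R x y : Finset V} (hR : R.card = r) (hx : x ∈ S.edges) (hy : y ∈ S.edges) (hRx : R ⊆ x)
    (hRy : R ⊆ y) : x = y :=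
  Finset.card_le_one.1 (hS R hR) x (Finset.mem_filter.2 ⟨hx, hRx⟩) y
    (Finset.mem_filter.2 ⟨hy, hRy⟩)

theorem injOn_fst_of_image_mem_edges {S : KGraph (r + 1) V} {e : Finset (V × Fin d)}
    (hc : e.card = r + 1) (he : e.image Prod.fst ∈ S.edges) :
    Set.InjOn Prod.fst (e : Set (V × Fin d)) := by
  rw [← Finset.card_image_iff, S.card_edge _ he, hc]

end General

section Basic

variable {k r : ℕ} {V : Type*} [Fintype V]

theorem indepNum_le_iff {H : KGraph k V} {c : ℕ} :
    H.indepNum ≤ c ↔ ∀ Z, H.IsIndep Z → Z.card ≤ c := by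
  simp [indepNum]

theorem IsIndep.card_le_indepNum {H : KGraph k V} {Z : Finset V} (hZ : H.IsIndep Z) :
    Z.card ≤ H.indepNum :=
  indepNum_le_iff.1 le_rfl Z hZ

theorem exists_isIndep_card_eq (H : KGraph (r + 1) V) :
    ∃ Z, H.IsIndep Z ∧ Z.card = H.indepNum := by
  classical
  have hne : ((Finset.univ : Finset (Finset V)).filter H.IsIndep).Nonempty := by
    refine ⟨∅, Finset.mem_filter.2 ⟨Finset.mem_univ _, fun e he hs => ?_⟩⟩
    have := H.card_edge e he
    rw [Finset.subset_empty.1 hs] at this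
    simp at this
  obtain ⟨Z, hZ, h⟩ := Finset.exists_mem_eq_sup _ hne Finset.card
  refine ⟨Z, (Finset.mem_filter.1 hZ).2, ?_⟩
  rw [indepNum, ← h]

theorem exists_isIndep_of_le_indepNum (H : KGraph (r + 1) V) {c : ℕ} (hc : c ≤ H.indepNum) :
    ∃ Z, H.IsIndep Z ∧ Z.card = c := by
  obtain ⟨Z, hZ, h⟩ := H.exists_isIndep_card_eq
  obtain ⟨Z', hZ', h'⟩ := Finset.exists_subset_card_eq (h ▸ hc)
  exact ⟨Z', fun e he hs => hZ e he (hs.trans hZ'), h'⟩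

theorem indepNum_le_of_edges_subset {H H' : KGraph k V} (h : H.edges ⊆ H'.edges) :
    H'.indepNum ≤ H.indepNum :=
  indepNum_le_iff.2 fun _ hZ => IsIndep.card_le_indepNum fun e he => hZ e (h he)

theorem indepNum_le_card (H : KGraph k V) : H.indepNum ≤ Fintype.card V :=
  indepNum_le_iff.2 fun Z _ => Z.card_le_univ

variable [DecidableEq V]

theorem maxDegree_le_iff {H : KGraph (r + 1) V} {c : ℕ} :
    H.maxDegree ≤ c ↔ ∀ R : Finset V, R.card = r → H.degree R ≤ c := by
  simp [maxDegree]

theorem degree_le_maxDegree (H : KGraph (r + 1) V) {R : Finset V} (hR : R.card = r) :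
    H.degree R ≤ H.maxDegree :=
  maxDegree_le_iff.1 le_rfl R hR

/-- A hypergraph with maximum degree at most `d` extends to one with maximum degree exactly `d`. -/
theorem exists_maxDegree_eq (H : KGraph (r + 1) V) {d : ℕ} (hd : H.maxDegree ≤ d)
    (hdV : d + r ≤ Fintype.card V) :
    ∃ H' : KGraph (r + 1) V, H.edges ⊆ H'.edges ∧ H'.maxDegree = d := by
  by_contra! hcon
  -- If degree `d` is never attained, edges can be added forever, which is absurd. An added edge
  -- raises each degree by at most one, and `d + r ≤ |V|` leaves a non-edge over any `r`-set of
  -- degree below `d`.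
  have step : ∀ j : ℕ, ∃ H' : KGraph (r + 1) V, H.edges ⊆ H'.edges ∧ H'.maxDegree ≤ d ∧
      j ≤ H'.edges.card := by
    intro j
    induction j with
    | zero => exact ⟨H, subset_rfl, hd, Nat.zero_le _⟩
    | succ j ih =>
      obtain ⟨H', hsub, hle, hj⟩ := ih
      have hlt : H'.maxDegree < d := lt_of_le_of_ne hle (hcon H' hsub)
      obtain ⟨R, -, hR⟩ := Finset.exists_subset_card_eq
        (show r ≤ (Finset.univ : Finset V).card by rw [Finset.card_univ]; omega)
      obtain ⟨v, hvR, hv⟩ : ∃ v, v ∉ R ∧ insert v R ∉ H'.edges := by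
        by_contra! hall
        have h1 := card_le_degree (H := H') (R := R) (X := Rᶜ)
          (fun v hv => Finset.mem_compl.1 hv) (fun v hv => hall v (Finset.mem_compl.1 hv))
        have h2 := H'.degree_le_maxDegree hR
        rw [Finset.card_compl] at h1
        omega
      refine ⟨⟨insert (insert v R) H'.edges, ?_⟩, hsub.trans (Finset.subset_insert _ _), ?_, ?_⟩
      · intro e he
        rcases Finset.mem_insert.1 he with rfl | he
        · rw [Finset.card_insert_of_notMem hvR, hR]
        · exact H'.card_edge e he
      · refine maxDegree_le_iff.2 fun Q hQ => ?_
        have h1 := H'.degree_le_maxDegree hQ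
        have h2 : (Finset.filter (fun e => Q ⊆ e) (insert (insert v R) H'.edges)).card
            ≤ H'.degree Q + 1 := by
          rw [Finset.filter_insert]
          split_ifs
          · exact Finset.card_insert_le _ _
          · exact Nat.le_succ _
        exact h2.trans (by omega)
      · rw [Finset.card_insert_of_notMem hv]; omega
  obtain ⟨H', -, -, h⟩ := step (Fintype.card (Finset V) + 1)
  have := H'.edges.card_le_univ
  omega

variable {W : Type*} [Fintype W] [DecidableEq W]

theorem indepNum_comap_le (H : KGraph k V) (f : W ↪ V) : (H.comap f).indepNum ≤ H.indepNum := by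
  refine indepNum_le_iff.2 fun Z hZ => ?_
  rw [← Finset.card_map f]
  refine IsIndep.card_le_indepNum fun e he hs => ?_
  obtain ⟨e', he', rfl⟩ := Finset.subset_map_iff.1 hs
  exact hZ e' (mem_comap_edges.2 he) he'

theorem maxDegree_comap_le (H : KGraph (r + 1) V) (f : W ↪ V) :
    (H.comap f).maxDegree ≤ H.maxDegree := by
  refine maxDegree_le_iff.2 fun R hR => ?_
  refine le_trans ?_ (H.degree_le_maxDegree (R := R.map f) (by rw [Finset.card_map, hR]))
  refine Finset.card_le_card_of_injOn (fun e => e.map f) (fun e he => ?_)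
    (Finset.map_injective f).injOn
  have := Finset.mem_filter.1 (Finset.mem_coe.1 he)
  exact Finset.mem_coe.2 (Finset.mem_filter.2
    ⟨mem_comap_edges.1 this.1, Finset.map_subset_map.2 this.2⟩)

end Basic

/-! ### Blowups -/

section Blowup

variable {r d : ℕ} {V : Type*} [Fintype V] [DecidableEq V]

theorem mem_blowup_edges {S : KGraph (r + 1) V} {e : Finset (V × Fin d)} :
    e ∈ (S.blowup d).edges ↔ e.card = r + 1 ∧
      ((∃ i : V, ∀ v ∈ e, v.1 = i) ∨ e.image Prod.fst ∈ S.edges) := by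
  simp only [blowup, Finset.mem_filter, Finset.mem_powersetCard, Finset.subset_univ, true_and]
  congr!

/-- All vertices completing `R` to an edge lie in one part. If `R` is inside a part, it is that
part: as `r ≥ 2`, two points of `R` have the same projection, so no transversal edge contains `R`.
Otherwise it is the part of the vertex missing from the unique edge of `S` that contains the
projection of `R`. -/
theorem degree_blowup_le (hr : 2 ≤ r) {S : KGraph (r + 1) V} (hS : S.IsPartialSteiner)
    {R : Finset (V × Fin d)} (hR : R.card = r) : (S.blowup d).degree R ≤ d := by
  have hins : ∀ e ∈ (S.blowup d).edges, R ⊆ e → ∃ v, v ∉ R ∧ e = insert v R := by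
    intro e he hRe
    have h1 : (e \ R).card = 1 := by
      rw [Finset.card_sdiff_of_subset hRe, (S.blowup d).card_edge e he, hR]; omega
    obtain ⟨v, hv⟩ := Finset.card_eq_one.1 h1
    have hv' : v ∈ e \ R := hv ▸ Finset.mem_singleton_self v
    refine ⟨v, (Finset.mem_sdiff.1 hv').2, ?_⟩
    rw [← Finset.sdiff_union_of_subset hRe, hv, Finset.insert_eq]
  -- The value `none` stands for the case in which no vertex completes `R`.
  obtain ⟨i, hi⟩ : ∃ i : Option V, ∀ v, v ∉ R → insert v R ∈ (S.blowup d).edges →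
      i = some v.1 := by
    by_cases hpart : ∃ i : V, ∀ v ∈ R, v.1 = i
    · obtain ⟨i, hi⟩ := hpart
      refine ⟨some i, fun v hv he => ?_⟩
      obtain ⟨a, ha, b, hb, hab⟩ := Finset.one_lt_card.1 (by omega : 1 < R.card)
      obtain ⟨hc, ⟨j, hj⟩ | him⟩ := mem_blowup_edges.1 he
      · rw [hj v (Finset.mem_insert_self _ _), ← hi a ha, hj a (Finset.mem_insert_of_mem ha)]
      · refine absurd (injOn_fst_of_image_mem_edges hc him ?_ ?_
          ((hi a ha).trans (hi b hb).symm)) hab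
        · exact Finset.mem_coe.2 (Finset.mem_insert_of_mem ha)
        · exact Finset.mem_coe.2 (Finset.mem_insert_of_mem hb)
    · have key : ∀ v, v ∉ R → insert v R ∈ (S.blowup d).edges →
          (insert v R).image Prod.fst ∈ S.edges ∧ (R.image Prod.fst).card = r ∧
          v.1 ∉ R.image Prod.fst := by
        intro v hv he
        obtain ⟨hc, ⟨j, hj⟩ | him⟩ := mem_blowup_edges.1 he
        · exact absurd ⟨j, fun w hw => hj w (Finset.mem_insert_of_mem hw)⟩ hpart
        · have hinj := injOn_fst_of_image_mem_edges hc him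
          refine ⟨him, ?_, fun hmem => ?_⟩
          · rw [Finset.card_image_of_injOn (hinj.mono ?_), hR]
            exact Finset.coe_subset.2 (Finset.subset_insert _ _)
          · obtain ⟨w, hw, hwv⟩ := Finset.mem_image.1 hmem
            have := hinj (Finset.mem_coe.2 (Finset.mem_insert_of_mem hw))
              (Finset.mem_coe.2 (Finset.mem_insert_self v R)) hwv
            exact hv (this ▸ hw)
      by_cases hex : ∃ w, w ∉ R ∧ insert w R ∈ (S.blowup d).edges
      · obtain ⟨w, hw, hwe⟩ := hex
        refine ⟨some w.1, fun v hv he => ?_⟩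
        obtain ⟨h1, h2, h3⟩ := key v hv he
        obtain ⟨h1', -, h3'⟩ := key w hw hwe
        have := hS.eq_of_subset h2 h1 h1' (Finset.image_subset_image (Finset.subset_insert _ _))
          (Finset.image_subset_image (Finset.subset_insert _ _))
        rw [Finset.image_insert, Finset.image_insert] at this
        have hv1 : v.1 ∈ insert w.1 (R.image Prod.fst) := this ▸ Finset.mem_insert_self _ _
        rw [(Finset.mem_insert.1 hv1).resolve_right h3]
      · exact ⟨none, fun v hv he => absurd ⟨v, hv, he⟩ hex⟩
  have hsub : (S.blowup d).edges.filter (fun e => R ⊆ e) ⊆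
      (Finset.univ : Finset (Fin d)).biUnion fun j =>
        (i.toFinset).image fun a => insert (a, j) R := by
    intro e he
    obtain ⟨he, hRe⟩ := Finset.mem_filter.1 he
    obtain ⟨v, hv, rfl⟩ := hins e he hRe
    have := hi v hv he
    simp only [this, Finset.mem_biUnion, Finset.mem_univ, true_and, Finset.mem_image]
    exact ⟨v.2, v.1, by simp, rfl⟩
  refine (Finset.card_le_card hsub).trans (Finset.card_biUnion_le.trans ?_)
  calc _ ≤ ∑ _j : Fin d, 1 := by
        refine Finset.sum_le_sum fun j _ => Finset.card_image_le.trans ?_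
        cases i <;> simp
    _ = d := by simp

theorem insert_image_mem_blowup_edges {S : KGraph (r + 1) V} {x : Finset V} (hx : x ∈ S.edges)
    {y : V} (hy : y ∈ x) (g : V → Fin d) (j : Fin d) :
    insert (y, j) ((x.erase y).image fun a => (a, g a)) ∈ (S.blowup d).edges := by
  have hinj : Function.Injective fun a : V => (a, g a) := fun a b h => (Prod.ext_iff.1 h).1
  have hc : ((x.erase y).image fun a => (a, g a)).card = r := by
    rw [Finset.card_image_of_injective _ hinj, Finset.card_erase_of_mem hy, S.card_edge x hx]
    omega
  refine mem_blowup_edges.2 ⟨?_, Or.inr ?_⟩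
  · rw [Finset.card_insert_of_notMem, hc]
    simp
  · have : (insert (y, j) ((x.erase y).image fun a => (a, g a))).image Prod.fst = x := by
      rw [Finset.image_insert, Finset.image_image]
      have : (Prod.fst ∘ fun a : V => (a, g a)) = id := rfl
      rw [this, Finset.image_id]
      exact Finset.insert_erase hy
    rwa [this]

/-- Degree `d` is attained by lifting an edge of `S` with one vertex `y` removed: every vertex over
`y` completes the lift. -/
theorem maxDegree_blowup (hr : 2 ≤ r) {S : KGraph (r + 1) V} (hS : S.IsPartialSteiner)
    (hne : S.edges.Nonempty) (hd : 1 ≤ d) : (S.blowup d).maxDegree = d := by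
  refine le_antisymm (maxDegree_le_iff.2 fun R hR => degree_blowup_le hr hS hR) ?_
  obtain ⟨x, hx⟩ := hne
  obtain ⟨y, hy⟩ : x.Nonempty := Finset.card_pos.1 (by rw [S.card_edge x hx]; omega)
  have hinj : Function.Injective fun a : V => (a, (⟨0, hd⟩ : Fin d)) :=
    fun a b h => (Prod.ext_iff.1 h).1
  have hc : ((x.erase y).image fun a => (a, (⟨0, hd⟩ : Fin d))).card = r := by
    rw [Finset.card_image_of_injective _ hinj, Finset.card_erase_of_mem hy, S.card_edge x hx]
    omega
  refine le_trans ?_ ((S.blowup d).degree_le_maxDegree hc)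
  have := card_le_degree (H := S.blowup d) (R := (x.erase y).image fun a => (a, (⟨0, hd⟩ : Fin d)))
    (X := (Finset.univ : Finset (Fin d)).image fun j => (y, j)) (by simp +contextual)
    (fun v hv => by
      obtain ⟨j, -, rfl⟩ := Finset.mem_image.1 hv
      exact insert_image_mem_blowup_edges hx hy (fun _ => ⟨0, hd⟩) j)
  rwa [Finset.card_image_of_injective _ (Prod.mk_right_injective y), Finset.card_univ,
    Fintype.card_fin] at this

/-- An edge of `S` inside the projection of `Z` lifts to an edge inside `Z`, and `r + 1` points of
one part form an edge. This bounds the projection and the fibres. For the converse, a product of a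
maximum independent set with `min r d` indices is independent. -/
theorem indepNum_blowup (S : KGraph (r + 1) V) (hd : 1 ≤ d) :
    (S.blowup d).indepNum = min r d * S.indepNum := by
  apply le_antisymm
  · refine indepNum_le_iff.2 fun Z hZ => ?_
    have hind : S.IsIndep (Z.image Prod.fst) := by
      intro x hx hs
      have hlift : ∀ a ∈ x, ∃ j, (a, j) ∈ Z := by
        intro a ha
        obtain ⟨⟨a', j⟩, hv, rfl⟩ := Finset.mem_image.1 (hs ha)
        exact ⟨j, hv⟩
      have : Nonempty (Fin d) := ⟨⟨0, hd⟩⟩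
      choose! g hg using hlift
      obtain ⟨y, hy⟩ : x.Nonempty := Finset.card_pos.1 (by rw [S.card_edge x hx]; omega)
      refine hZ _ (insert_image_mem_blowup_edges hx hy g (g y)) ?_
      intro v hv
      rcases Finset.mem_insert.1 hv with rfl | hv
      · exact hg y hy
      · obtain ⟨a, ha, rfl⟩ := Finset.mem_image.1 hv
        exact hg a (Finset.mem_of_mem_erase ha)
    calc Z.card ≤ min r d * (Z.image Prod.fst).card := by
          refine Finset.card_le_mul_card_image Z _ fun a _ => le_min ?_ ?_
          · by_contra! hlt
            obtain ⟨e, he, hc⟩ := Finset.exists_subset_card_eq (Nat.succ_le_of_lt hlt)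
            refine hZ e (mem_blowup_edges.2 ⟨hc, Or.inl ⟨a, fun v hv => ?_⟩⟩)
              (he.trans (Finset.filter_subset _ _))
            exact (Finset.mem_filter.1 (he hv)).2
          · calc _ ≤ ((Finset.univ : Finset (Fin d)).image fun j => (a, j)).card := by
                  refine Finset.card_le_card fun v hv => ?_
                  have := (Finset.mem_filter.1 hv).2
                  exact Finset.mem_image.2 ⟨v.2, Finset.mem_univ _, by rw [← this]⟩
              _ ≤ d := Finset.card_image_le.trans (by simp)
      _ ≤ _ := Nat.mul_le_mul_left _ hind.card_le_indepNum
  · obtain ⟨Z, hZ, hc⟩ := S.exists_isIndep_card_eq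
    obtain ⟨J, -, hJ⟩ := Finset.exists_subset_card_eq
      (show min r d ≤ (Finset.univ : Finset (Fin d)).card by simp)
    have hind : (S.blowup d).IsIndep (Z ×ˢ J) := by
      intro e he hs
      obtain ⟨hec, ⟨i, hi⟩ | him⟩ := mem_blowup_edges.1 he
      · have h1 : e ⊆ J.image fun j => (i, j) := by
          intro v hv
          exact Finset.mem_image.2 ⟨v.2, (Finset.mem_product.1 (hs hv)).2, by rw [← hi v hv]⟩
        have := (Finset.card_le_card h1).trans Finset.card_image_le
        have := min_le_left r d
        omega
      · refine hZ _ him fun a ha => ?_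
        obtain ⟨v, hv, rfl⟩ := Finset.mem_image.1 ha
        exact (Finset.mem_product.1 (hs hv)).1
    have := hind.card_le_indepNum
    rwa [Finset.card_product, hc, hJ, mul_comm] at this

end Blowup

/-- A blowup of a partial Steiner system with `m` vertices, cut down to `n` vertices by shrinking
its last part. -/
theorem exists_of_isPartialSteiner {r d m n : ℕ} (hr : 2 ≤ r) (hd : 1 ≤ d) (hn : n ≤ (m + 1) * d)
    (hmn : m * d < n) {S : KGraph (r + 1) (Fin (m + 1))} (hS : S.IsPartialSteiner)
    (hne : S.edges.Nonempty) :
    ∃ H : KGraph (r + 1) (Fin n), H.maxDegree = d ∧ H.indepNum ≤ r * S.indepNum := by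
  have hdm : ∀ i : Fin n, (i : ℕ) / d < m + 1 := fun i =>
    (Nat.div_lt_iff_lt_mul hd).2 (i.2.trans_le hn)
  -- The parts become consecutive intervals of length `d`, so only the last one is truncated, and it
  -- keeps a point because `m * d < n`.
  let f : Fin n ↪ Fin (m + 1) × Fin d :=
    ⟨fun i => (⟨i / d, hdm i⟩, ⟨i % d, Nat.mod_lt _ hd⟩), fun i j h => by
      simp only [Prod.mk.injEq, Fin.mk.injEq] at h
      ext
      rw [← Nat.div_add_mod (i : ℕ) d, h.1, h.2, Nat.div_add_mod]⟩
  have hf : ∀ v : Fin (m + 1) × Fin d, (v.1 : ℕ) * d + v.2 < n → ∃ i, f i = v := by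
    intro v hv
    refine ⟨⟨v.1 * d + v.2, hv⟩, ?_⟩
    have h1 : ((v.1 : ℕ) * d + v.2) / d = v.1 := by
      rw [mul_comm, Nat.mul_add_div hd, Nat.div_eq_of_lt v.2.2, add_zero]
    have h2 : ((v.1 : ℕ) * d + v.2) % d = v.2 := by
      rw [mul_comm, Nat.mul_add_mod, Nat.mod_eq_of_lt v.2.2]
    ext
    · exact h1
    · exact h2
  refine ⟨(S.blowup d).comap f, le_antisymm ?_ ?_, ?_⟩
  · exact (maxDegree_comap_le _ f).trans (maxDegree_blowup hr hS hne hd).le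
  · obtain ⟨x, hx⟩ := hne
    -- The part over `y` is complete and supplies `d` edges. The other vertices of `x` are
    -- represented by the first point of their parts, which is present even in the last part.
    obtain ⟨y, hy, hym⟩ : ∃ y ∈ x, y ≠ Fin.last m := by
      by_contra! hall
      have : x ⊆ {Fin.last m} := fun y hy => Finset.mem_singleton.2 (hall y hy)
      have := Finset.card_le_card this
      rw [S.card_edge x hx, Finset.card_singleton] at this
      omega
    have hyn : ∀ j : Fin d, (y : ℕ) * d + j < n := by
      intro j
      have h1 : (y : ℕ) + 1 ≤ m := by
        have := Fin.val_lt_last hym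
        omega
      have h2 := Nat.mul_le_mul_right d h1
      have := j.2
      rw [add_mul] at h2
      omega
    have h0n : ∀ a : Fin (m + 1), (a : ℕ) * d + ((⟨0, hd⟩ : Fin d) : ℕ) < n := by
      intro a
      have h2 := Nat.mul_le_mul_right d (Nat.lt_succ_iff.1 a.2)
      simp only [add_zero]
      omega
    choose u hu using fun j : Fin d => hf (y, j) (hyn j)
    choose w hw using fun a : Fin (m + 1) => hf (a, ⟨0, hd⟩) (h0n a)
    have hwi : Function.Injective w := fun a b h => by
      have := (hw a).symm.trans ((congrArg f h).trans (hw b))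
      exact (Prod.ext_iff.1 this).1
    have hui : Function.Injective u := fun a b h => by
      have := (hu a).symm.trans ((congrArg f h).trans (hu b))
      exact (Prod.ext_iff.1 this).2
    have hc : ((x.erase y).image w).card = r := by
      rw [Finset.card_image_of_injective _ hwi, Finset.card_erase_of_mem hy, S.card_edge x hx]
      omega
    refine le_trans ?_ (degree_le_maxDegree _ hc)
    have := card_le_degree (H := (S.blowup d).comap f) (R := (x.erase y).image w)
      (X := Finset.univ.image u) ?_ ?_
    · rwa [Finset.card_image_of_injective _ hui, Finset.card_univ, Fintype.card_fin] at this
    · intro v hv hv'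
      obtain ⟨j, -, rfl⟩ := Finset.mem_image.1 hv
      obtain ⟨a, ha, h⟩ := Finset.mem_image.1 hv'
      have := (hw a).symm.trans ((congrArg f h).trans (hu j))
      exact Finset.ne_of_mem_erase ha (Prod.ext_iff.1 this).1
    · intro v hv
      obtain ⟨j, -, rfl⟩ := Finset.mem_image.1 hv
      rw [mem_comap_edges]
      have := insert_image_mem_blowup_edges hx hy (fun _ => (⟨0, hd⟩ : Fin d)) j
      convert this using 1
      rw [Finset.map_insert, hu, Finset.map_eq_image, Finset.image_image]
      congr 2
      funext a
      exact hw a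
  · refine (indepNum_comap_le _ f).trans ?_
    rw [indepNum_blowup S hd]
    exact Nat.mul_le_mul_right _ (min_le_left _ _)

end KGraph

/-! ### Partial Steiner systems with small independence number -/

namespace KGraph

section Conflicts

variable {V : Type*} [Fintype V] [DecidableEq V]

/-- The `(r+1)`-sets other than `e` that share `r` elements with `e`. -/
def conflicts (r : ℕ) (e : Finset V) : Finset (Finset V) :=
  (Finset.univ.powersetCard (r + 1)).filter fun f => e ≠ f ∧ r ≤ (e ∩ f).card

/-- Such a set arises from `e` by exchanging one of its `r + 1` elements for another vertex. -/
theorem card_conflicts_le {r : ℕ} {e : Finset V} (he : e.card = r + 1) :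
    (conflicts r e).card ≤ (r + 1) * Fintype.card V := by
  have hsub : conflicts r e ⊆
      (e ×ˢ (Finset.univ : Finset V)).image fun x => insert x.2 (e.erase x.1) := by
    intro f hf
    simp only [conflicts, Finset.mem_filter, Finset.mem_powersetCard, Finset.subset_univ,
      true_and] at hf
    obtain ⟨hfc, hne, hr⟩ := hf
    have hlt : (e ∩ f).card < r + 1 := by
      by_contra! hge
      have h1 : e ∩ f = e := Finset.eq_of_subset_of_card_le Finset.inter_subset_left (by omega)
      have h2 : e ∩ f = f := Finset.eq_of_subset_of_card_le Finset.inter_subset_right (by omega)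
      exact hne (h1.symm.trans h2)
    have h1 := Finset.card_sdiff_add_card_inter e f
    have h2 := Finset.card_sdiff_add_card_inter f e
    rw [Finset.inter_comm f e] at h2
    obtain ⟨u, hu⟩ := Finset.card_eq_one.1 (show (e \ f).card = 1 by omega)
    obtain ⟨v, hv⟩ := Finset.card_eq_one.1 (show (f \ e).card = 1 by omega)
    have hue : u ∈ e := (Finset.mem_sdiff.1 (hu ▸ Finset.mem_singleton_self u)).1
    refine Finset.mem_image.2 ⟨(u, v), by simp [hue], ?_⟩
    have h3 : e.erase u = e ∩ f := by
      rw [← Finset.sdiff_singleton_eq_erase, ← hu, sdiff_sdiff_right_self]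
      rfl
    simp only [h3]
    rw [Finset.insert_eq, ← hv, Finset.inter_comm, Finset.sdiff_union_inter]
  refine (Finset.card_le_card hsub).trans (Finset.card_image_le.trans ?_)
  rw [Finset.card_product, he, Finset.card_univ]

/-- The pairs of `(r+1)`-sets sharing `r` elements, at least one of which belongs to `W`. -/
def conflictPairs (r : ℕ) (W : Finset (Finset V)) : Finset (Finset V × Finset V) :=
  ((Finset.univ.powersetCard (r + 1)) ×ˢ (Finset.univ.powersetCard (r + 1))).filter
    fun x => x.1 ≠ x.2 ∧ r ≤ (x.1 ∩ x.2).card ∧ (x.1 ∈ W ∨ x.2 ∈ W)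

theorem card_conflictPairs_le {r : ℕ} {W : Finset (Finset V)}
    (hW : W ⊆ Finset.univ.powersetCard (r + 1)) :
    (conflictPairs r W).card ≤ W.card * (2 * ((r + 1) * Fintype.card V)) := by
  have hsub : conflictPairs r W ⊆ W.biUnion fun e =>
      (conflicts r e).image (fun f => (e, f)) ∪ (conflicts r e).image (fun f => (f, e)) := by
    rintro ⟨e, f⟩ h
    simp only [conflictPairs, Finset.mem_filter, Finset.mem_product] at h
    obtain ⟨⟨he, hf⟩, hne, hr, h⟩ := h
    refine Finset.mem_biUnion.2 ?_
    rcases h with h | h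
    · refine ⟨e, h, Finset.mem_union_left _ (Finset.mem_image.2 ⟨f, ?_, rfl⟩)⟩
      exact Finset.mem_filter.2 ⟨hf, hne, hr⟩
    · refine ⟨f, h, Finset.mem_union_right _ (Finset.mem_image.2 ⟨e, ?_, rfl⟩)⟩
      exact Finset.mem_filter.2 ⟨he, hne.symm, by rwa [Finset.inter_comm]⟩
  refine (Finset.card_le_card hsub).trans (Finset.card_biUnion_le_card_mul _ _ _ fun e he => ?_)
  have h1 := card_conflicts_le (r := r) (Finset.mem_powersetCard.1 (hW he)).2
  rw [two_mul]
  exact (Finset.card_union_le _ _).trans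
    (add_le_add (Finset.card_image_le.trans h1) (Finset.card_image_le.trans h1))

/-- A partial Steiner system meeting every `k`-set, by the local lemma. -/
theorem exists_isPartialSteiner_of_pow_le {r k : ℕ} {p : ℝ} (hp0 : 0 < p)
    (hV : 0 < Fintype.card V) (hp : 32 * (r + 1) * Fintype.card V * p = 1)
    (hk : 4 * ((Fintype.card V).choose k : ℝ) * (1 - p / 2) ^ (k.choose (r + 1)) ≤ 1) :
    ∃ S : KGraph (r + 1) V, S.IsPartialSteiner ∧ ∀ K : Finset V, K.card = k → ¬ S.IsIndep K := by
  classical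
  by_cases hkV : Fintype.card V < k
  · refine ⟨⟨∅, by simp⟩, fun R _ => by simp [degree], fun K hK => ?_⟩
    have := K.card_le_univ
    omega
  rw [not_lt] at hkV
  set m := Fintype.card V with hm
  set M := m.choose k with hM
  have hM1 : (1 : ℝ) ≤ M := by exact_mod_cast Nat.choose_pos hkV
  have hm1 : (1 : ℝ) ≤ m := by exact_mod_cast hV
  have hr0 : (0 : ℝ) ≤ r := Nat.cast_nonneg r
  have hp32 : 32 * p ≤ 1 := by
    rw [← hp]
    have : (1 : ℝ) ≤ (r + 1) * m := by nlinarith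
    nlinarith
  set U : Finset (Finset V) := Finset.univ.powersetCard (r + 1) with hU
  set Ks : Finset (Finset V) := Finset.univ.powersetCard k with hKs
  have hKsc : Ks.card = M := by rw [hKs, Finset.card_powersetCard, Finset.card_univ]
  let sup : (Finset V × Finset V) ⊕ Finset V → Finset (Finset V) :=
    Sum.elim (fun x => {x.1, x.2}) (fun K => K.powersetCard (r + 1))
  let bad : (Finset V × Finset V) ⊕ Finset V → Set (Finset (Finset V)) :=
    Sum.elim (fun x => {G | {x.1, x.2} ⊆ G}) (fun K => {G | Disjoint G (K.powersetCard (r + 1))})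
  -- The weights are constant multiples of the intended bounds: a conflict has probability `p²`, and
  -- there are `M` events of the second kind, of total weight `1/2`.
  let wt : (Finset V × Finset V) ⊕ Finset V → ℝ :=
    Sum.elim (fun _ => 4 * p ^ 2) (fun _ => 1 / (2 * M))
  let nb : (Finset V × Finset V) ⊕ Finset V → Finset ((Finset V × Finset V) ⊕ Finset V) :=
    fun i => (conflictPairs r (sup i)).disjSum Ks
  have hsup : ∀ i ∈ (conflictPairs r U).disjSum Ks, sup i ⊆ U := by
    rintro (⟨e, f⟩ | K) hi
    · simp only [Finset.inl_mem_disjSum, conflictPairs, Finset.mem_filter,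
        Finset.mem_product] at hi
      intro g hg
      simp only [sup, Sum.elim_inl, Finset.mem_insert, Finset.mem_singleton] at hg
      rcases hg with rfl | rfl
      · exact hi.1.1
      · exact hi.1.2
    · exact Finset.powersetCard_mono (Finset.subset_univ _)
  -- Bernoulli's inequality twice. Each element of the support meets at most `2(r+1)m` conflict
  -- pairs of weight `4p²`, in total `8(r+1)mp² = p/4`. The `M` sets of size `k` contribute a factor
  -- at least `1/2`.
  have hprod : ∀ i, (sup i ⊆ U) →
      (1 - p / 4) ^ (sup i).card / 2 ≤ ∏ j ∈ nb i, (1 - wt j) := by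
    intro i hi
    simp only [nb, wt, Finset.prod_disjSum, Sum.elim_inl, Sum.elim_inr, Finset.prod_const, hKsc]
    have h1 : (1 - p / 4) ^ (sup i).card ≤ (1 - 4 * p ^ 2) ^ (conflictPairs r (sup i)).card := by
      refine le_trans ?_ (pow_le_pow_of_le_one (by nlinarith) (by nlinarith)
        (card_conflictPairs_le hi))
      rw [mul_comm (sup i).card, pow_mul]
      refine pow_le_pow_left₀ (by linarith) ?_ _
      have h2 := one_add_mul_le_pow (a := -(4 * p ^ 2)) (by nlinarith)
        (2 * ((r + 1) * Fintype.card V))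
      rw [← sub_eq_add_neg] at h2
      refine le_trans (le_of_eq ?_) h2
      push_cast
      rw [← hm]
      linear_combination (p / 4) * hp
    have h3 : (1 : ℝ) / 2 ≤ (1 - 1 / (2 * M)) ^ M := by
      have h4 : (1 : ℝ) / (2 * M) ≤ 1 := by
        rw [div_le_one (by linarith)]; linarith
      have h2 := one_add_mul_le_pow (a := -((1 : ℝ) / (2 * M))) (by linarith) M
      rw [← sub_eq_add_neg] at h2
      refine le_trans (le_of_eq ?_) h2
      field_simp
      norm_num
    rw [div_eq_mul_one_div]
    exact mul_le_mul h1 h3 (by norm_num) (pow_nonneg (by nlinarith) _)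
  have hex : ∃ G ⊆ U, ∀ i ∈ (conflictPairs r U).disjSum Ks, G ∉ bad i := by
    refine exists_avoiding_of_local_lemma (p := p) hp0.le (by linarith) _ bad sup nb wt hsup
      ?_ ?_ ?_ ?_ ?_
    · rintro (⟨e, f⟩ | K) _ H _
      · simp [bad, sup, Finset.subset_inter_iff]
      · simp only [bad, sup, Sum.elim_inr, Set.mem_ofPred_eq, Finset.disjoint_iff_inter_eq_empty,
          Finset.inter_assoc, Finset.inter_self]
    · intro i _ j hj hij
      rcases j with ⟨e, f⟩ | K
      · simp only [nb, Finset.inl_mem_disjSum, conflictPairs, Finset.mem_filter] at hj hij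
        simp only [sup, Sum.elim_inl, Finset.disjoint_insert_right, Finset.disjoint_singleton_right]
        by_contra hcon
        refine hij ⟨hj.1, hj.2.1, hj.2.2.1, ?_⟩
        by_contra hcon'
        exact hcon (not_or.1 hcon')
      · exact absurd hj (by simpa [nb] using hij)
    · rintro (_ | _)
      · simp only [wt, Sum.elim_inl]; positivity
      · simp only [wt, Sum.elim_inr]; positivity
    · rintro (_ | _)
      · simp only [wt, Sum.elim_inl]; nlinarith
      · simp only [wt, Sum.elim_inr]
        rw [div_lt_one (by linarith)]; linarith
    · intro i hi
      refine le_trans ?_ (mul_le_mul_of_nonneg_left (hprod i (hsup i hi)) ?_)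
      · have hsi := hsup i hi
        rcases i with ⟨e, f⟩ | K
        · simp only [bad, wt, sup, Sum.elim_inl] at hsi ⊢
          have hef : e ≠ f := (Finset.mem_filter.1 (Finset.inl_mem_disjSum.1 hi)).2.1
          rw [bernProb_subset hsi, Finset.card_pair hef]
          have : 1 - p / 2 ≤ (1 - p / 4) ^ 2 := by nlinarith
          nlinarith [sq_nonneg p]
        · simp only [bad, wt, sup, Sum.elim_inr] at hsi ⊢
          have hK : K.card = k :=
            (Finset.mem_powersetCard.1 (Finset.inr_mem_disjSum.1 hi)).2
          rw [bernProb_disjoint hsi, Finset.card_powersetCard, hK]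
          -- The first factor is at most `1/(4M)` by `hk`; the second pays for the neighbouring
          -- conflicts.
          have h1 : (1 - p) ^ k.choose (r + 1) ≤
              (1 - p / 2) ^ k.choose (r + 1) * (1 - p / 4) ^ k.choose (r + 1) := by
            rw [← mul_pow]
            exact pow_le_pow_left₀ (by linarith) (by nlinarith) _
          refine h1.trans ?_
          have h2 : (0 : ℝ) ≤ (1 - p / 4) ^ k.choose (r + 1) := pow_nonneg (by linarith) _
          have h3 : (1 - p / 2) ^ k.choose (r + 1) ≤ 1 / (4 * M) := by
            rw [le_div_iff₀ (by linarith)]; linarith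
          calc _ ≤ 1 / (4 * M) * (1 - p / 4) ^ k.choose (r + 1) :=
                mul_le_mul_of_nonneg_right h3 h2
            _ = _ := by ring
      · rcases i with _ | _
        · simp only [wt, Sum.elim_inl]; positivity
        · simp only [wt, Sum.elim_inr]; positivity
  obtain ⟨G, hGU, hG⟩ := hex
  have hGc : ∀ e ∈ G, e.card = r + 1 := fun e he => (Finset.mem_powersetCard.1 (hGU he)).2
  refine ⟨⟨G, hGc⟩, fun R hR => ?_, fun K hK hind => ?_⟩
  · refine Finset.card_le_one.2 fun e he f hf => ?_
    simp only [Finset.mem_filter] at he hf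
    by_contra hne
    refine hG (Sum.inl (e, f)) ?_ ?_
    · simp only [Finset.inl_mem_disjSum, conflictPairs, Finset.mem_filter, Finset.mem_product]
      refine ⟨⟨hGU he.1, hGU hf.1⟩, hne, ?_, Or.inl (hGU he.1)⟩
      rw [← hR]
      exact Finset.card_le_card (Finset.subset_inter he.2 hf.2)
    · simp only [bad, Sum.elim_inl, Set.mem_ofPred_eq]
      intro g hg
      rcases Finset.mem_insert.1 hg with rfl | hg
      · exact he.1
      · rw [Finset.mem_singleton.1 hg]; exact hf.1
  · refine hG (Sum.inr K) (by simp [hKs, hK]) ?_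
    simp only [bad, Sum.elim_inr, Set.mem_ofPred_eq]
    refine Finset.disjoint_left.2 fun e he heK => ?_
    exact hind e he (Finset.mem_powersetCard.1 heK).1

end Conflicts

/-- For `t` at least an explicit constant, `p` of order `1 / m` and `k ≥ t (m log m)^{1/r}`, the
expected number of independent `k`-sets is small. -/
theorem choose_mul_pow_le_one {r m k : ℕ} {p t : ℝ} (hr : 2 ≤ r) (hm : 3 ≤ m) (hp0 : 0 < p)
    (hp1 : p ≤ 1) (hp : 32 * (r + 1) * m * p = 1)
    (ht : 128 * (r + 1) * 2 ^ (r + 1) * (r + 1).factorial ≤ t)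
    (hk : t * ((m : ℝ) * Real.log m) ^ (1 / (r : ℝ)) ≤ k) :
    4 * (m.choose k : ℝ) * (1 - p / 2) ^ (k.choose (r + 1)) ≤ 1 := by
  have hm3 : (3 : ℝ) ≤ m := by exact_mod_cast hm
  have hlog : 1 ≤ Real.log m := by
    rw [Real.le_log_iff_exp_le (by linarith)]
    linarith [Real.exp_one_lt_d9]
  have hr2 : (2 : ℝ) ≤ r := by exact_mod_cast hr
  have hfac : (1 : ℝ) ≤ (r + 1).factorial := by
    exact_mod_cast Nat.one_le_iff_ne_zero.2 (Nat.factorial_ne_zero _)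
  have h2r : (1 : ℝ) ≤ 2 ^ (r + 1) := one_le_pow₀ (by norm_num)
  have hC : 128 * ((r : ℝ) + 1) ≤ 128 * (r + 1) * 2 ^ (r + 1) * (r + 1).factorial := by
    have : (1 : ℝ) ≤ 2 ^ (r + 1) * (r + 1).factorial := by nlinarith
    rw [mul_assoc (128 * ((r : ℝ) + 1))]
    nlinarith
  have ht1 : 1 ≤ t := by linarith
  have hml : 1 ≤ (m : ℝ) * Real.log m := by nlinarith
  set y := ((m : ℝ) * Real.log m) ^ (1 / (r : ℝ)) with hy
  have hy1 : 1 ≤ y := Real.one_le_rpow hml (by positivity)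
  have hyr : y ^ r = m * Real.log m := by
    rw [hy, one_div, Real.rpow_inv_natCast_pow (by linarith) (by omega)]
  have htk : t ≤ k := by nlinarith
  have hk2 : 2 * r ≤ k := by
    have : (2 * r : ℝ) ≤ k := by linarith
    exact_mod_cast this
  have hk0 : (0 : ℝ) < k := by linarith
  have hkr : t * (m * Real.log m) ≤ (k : ℝ) ^ r := by
    calc t * (m * Real.log m) ≤ t ^ r * y ^ r := by
          rw [hyr]
          exact mul_le_mul_of_nonneg_right (le_self_pow₀ ht1 (by omega)) (by linarith)
      _ = (t * y) ^ r := (mul_pow _ _ _).symm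
      _ ≤ _ := pow_le_pow_left₀ (by positivity) hk _
  -- Each of the `r + 1` factors of the falling factorial is at least `k - r ≥ k/2`.
  have hN : (k : ℝ) ^ (r + 1) ≤ k.choose (r + 1) * (2 ^ (r + 1) * (r + 1).factorial) := by
    have h1 := Nat.pow_le_choose (α := ℝ) (r + 1) k
    rw [div_le_iff₀ (by linarith)] at h1
    have h2 : (k : ℝ) ≤ 2 * ((k + 1 - (r + 1) : ℕ) : ℝ) := by
      have : k ≤ 2 * (k + 1 - (r + 1)) := by omega
      exact_mod_cast this
    calc (k : ℝ) ^ (r + 1) ≤ (2 * ((k + 1 - (r + 1) : ℕ) : ℝ)) ^ (r + 1) :=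
          pow_le_pow_left₀ hk0.le h2 _
      _ = 2 ^ (r + 1) * ((k + 1 - (r + 1) : ℕ) : ℝ) ^ (r + 1) := mul_pow _ _ _
      _ ≤ 2 ^ (r + 1) * (k.choose (r + 1) * (r + 1).factorial) :=
          mul_le_mul_of_nonneg_left h1 (by positivity)
      _ = _ := by ring
  -- The factor 4 is `128(r+1)m p`. It makes the probability at most `m^(-2k)`, which beats `4 *
  -- m^k`, as `4 ≤ m^k`.
  have hpN : 4 * (k * Real.log m) ≤ p * k.choose (r + 1) := by
    have hD : (0 : ℝ) < 2 ^ (r + 1) * (r + 1).factorial := by positivity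
    have h1 : 128 * (r + 1) * (2 ^ (r + 1) * (r + 1).factorial) * (m * Real.log m) * k
        ≤ k.choose (r + 1) * (2 ^ (r + 1) * (r + 1).factorial) := by
      refine le_trans ?_ hN
      rw [pow_succ]
      refine mul_le_mul_of_nonneg_right (le_trans ?_ hkr) hk0.le
      refine mul_le_mul_of_nonneg_right (le_trans (le_of_eq ?_) ht) (by linarith)
      ring
    have h2 : 128 * (r + 1) * (m * Real.log m) * k ≤ k.choose (r + 1) := by
      refine le_of_mul_le_mul_right (le_trans (le_of_eq ?_) h1) hD
      ring
    have h3 := mul_le_mul_of_nonneg_left h2 hp0.le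
    refine le_trans (le_of_eq ?_) h3
    linear_combination (-(4 * k * Real.log m)) * hp
  have hexp : (1 - p / 2) ^ (k.choose (r + 1)) ≤ Real.exp (-(2 * (k * Real.log m))) := by
    have h1 : 1 - p / 2 ≤ Real.exp (-(p / 2)) := by
      have := Real.add_one_le_exp (-(p / 2)); linarith
    refine (pow_le_pow_left₀ (by linarith) h1 _).trans ?_
    rw [← Real.exp_nat_mul, Real.exp_le_exp]
    linarith
  have hch : (m.choose k : ℝ) ≤ Real.exp (k * Real.log m) := by
    rw [Real.exp_nat_mul, Real.exp_log (by linarith)]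
    exact_mod_cast Nat.choose_le_pow m k
  have h4 : (4 : ℝ) ≤ Real.exp (k * Real.log m) := by
    have := Real.add_one_le_exp (k * Real.log m)
    have : (4 : ℝ) ≤ k := by linarith
    nlinarith
  calc 4 * (m.choose k : ℝ) * (1 - p / 2) ^ (k.choose (r + 1))
      ≤ Real.exp (k * Real.log m) * Real.exp (k * Real.log m)
        * Real.exp (-(2 * (k * Real.log m))) := by
        refine mul_le_mul (mul_le_mul h4 hch (Nat.cast_nonneg _) (Real.exp_pos _).le) hexp
          (pow_nonneg (by linarith) _) (by positivity)
    _ = 1 := by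
        rw [← Real.exp_add, ← Real.exp_add, ← Real.exp_zero]
        congr 1; ring

/-- Partial Steiner systems with small independence number. -/
theorem exists_isPartialSteiner_indepNum_le {r : ℕ} (hr : 2 ≤ r) :
    ∃ a : ℝ, 0 < a ∧ ∀ m : ℕ, r + 1 ≤ m → ∃ S : KGraph (r + 1) (Fin m), S.IsPartialSteiner ∧
      S.edges.Nonempty ∧ (S.indepNum : ℝ) ≤ a * ((m : ℝ) * Real.log m) ^ (1 / (r : ℝ)) := by
  refine ⟨128 * (r + 1) * 2 ^ (r + 1) * (r + 1).factorial, by positivity, fun m hm => ?_⟩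
  set t : ℝ := 128 * (r + 1) * 2 ^ (r + 1) * (r + 1).factorial with ht
  set y := ((m : ℝ) * Real.log m) ^ (1 / (r : ℝ)) with hy
  have hm0 : (0 : ℝ) < m := by
    have : 0 < m := by omega
    exact_mod_cast this
  have hty : 0 ≤ t * y := by
    have : 0 ≤ Real.log m := Real.log_natCast_nonneg m
    positivity
  set k := ⌊t * y⌋₊ + 1 with hk
  have hle : ∀ j : ℕ, j < k → (j : ℝ) ≤ t * y := fun j hj =>
    (Nat.le_floor_iff hty).1 (Nat.lt_succ_iff.1 hj)
  -- If `k > m`, the bound exceeds the trivial one, and a single edge suffices; an edge is needed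
  -- for the blowups to have degree `d`.
  by_cases hkm : k ≤ m
  · set p : ℝ := 1 / (32 * (r + 1) * m) with hp
    have hp0 : 0 < p := by positivity
    have hp' : 32 * (r + 1) * m * p = 1 := by rw [hp]; field_simp
    have hp1 : p ≤ 1 := by
      rw [hp, div_le_one (by positivity)]
      have : (1 : ℝ) ≤ m := by exact_mod_cast (by omega : 1 ≤ m)
      have : (0 : ℝ) ≤ r := Nat.cast_nonneg r
      nlinarith
    have hkb : t * y ≤ k := by
      rw [hk]; push_cast; exact (Nat.lt_floor_add_one _).le
    have hc := choose_mul_pow_le_one hr (by omega) hp0 hp1 hp' le_rfl hkb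
    obtain ⟨S, hS, hK⟩ := exists_isPartialSteiner_of_pow_le (V := Fin m) (r := r) (k := k) hp0
      (by rw [Fintype.card_fin]; omega) (by rwa [Fintype.card_fin]) (by rwa [Fintype.card_fin])
    refine ⟨S, hS, ?_, hle _ ?_⟩
    · obtain ⟨K, -, hKc⟩ := Finset.exists_subset_card_eq
        (show k ≤ (Finset.univ : Finset (Fin m)).card by simpa using hkm)
      by_contra hne
      rw [Finset.not_nonempty_iff_eq_empty] at hne
      exact hK K hKc fun e he => by simp [hne] at he
    · by_contra! hlt
      obtain ⟨Z, hZ, hZc⟩ := S.exists_isIndep_of_le_indepNum hlt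
      exact hK Z hZc hZ
  · obtain ⟨e, -, he⟩ := Finset.exists_subset_card_eq
      (show r + 1 ≤ (Finset.univ : Finset (Fin m)).card by simpa using hm)
    refine ⟨⟨{e}, by simpa using he⟩, fun R _ => ?_, Finset.singleton_nonempty e, hle _ ?_⟩
    · exact (Finset.card_filter_le _ _).trans (Finset.card_singleton e).le
    · refine lt_of_le_of_lt (indepNum_le_card _) ?_
      rw [Fintype.card_fin]; omega

end KGraph

/-! ### Examples for all `n > r d` -/

namespace KGraph

/-- The crude bound `C^{1/r} ≤ C` is enough wherever constants leave the root. -/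
theorem rpow_one_div_mul_le {r : ℕ} (hr : 1 ≤ r) {C x : ℝ} (hC : 1 ≤ C) (hx : 0 ≤ x) :
    (C * x) ^ (1 / (r : ℝ)) ≤ C * x ^ (1 / (r : ℝ)) := by
  rw [Real.mul_rpow (by linarith) hx]
  refine mul_le_mul_of_nonneg_right ?_ (Real.rpow_nonneg hx _)
  refine (Real.rpow_le_rpow_of_exponent_le hC ?_).trans (Real.rpow_one C).le
  rw [div_le_one (by exact_mod_cast hr)]
  exact_mod_cast hr

/-- Examples with `n` vertices and maximum degree `d`, for all `n > r d`. -/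
theorem exists_maxDegree_eq_indepNum_le {r : ℕ} (hr : 2 ≤ r) :
    ∃ b : ℝ, 0 < b ∧ ∀ d n : ℕ, 1 ≤ d → r * d < n →
      ∃ H : KGraph (r + 1) (Fin n), H.maxDegree = d ∧
        (H.indepNum : ℝ) ≤ b * ((n : ℝ) / d * Real.log ((n : ℝ) / d)) ^ (1 / (r : ℝ)) := by
  obtain ⟨a, ha, hS⟩ := exists_isPartialSteiner_indepNum_le hr
  have hr0 : (0 : ℝ) < r := by exact_mod_cast (by omega : 0 < r)
  refine ⟨r * (a * 4), by positivity, fun d n hd hn => ?_⟩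
  -- Here `m + 1 = ⌈n/d⌉`, that is `m d < n ≤ (m+1) d`; the subtraction of one covers the case `d ∣
  -- n`.
  set m := (n - 1) / d with hm
  have hmd : m * d < n := by
    have := Nat.div_mul_le_self (n - 1) d
    rw [← hm] at this
    omega
  have hnm : n ≤ (m + 1) * d := by
    have := Nat.lt_mul_div_succ (n - 1) hd
    rw [← hm, mul_comm] at this
    omega
  have hrm : r ≤ m := (Nat.le_div_iff_mul_le hd).2 (by omega)
  obtain ⟨S, hSt, hne, hα⟩ := hS (m + 1) (by omega)
  obtain ⟨H, hH, hHα⟩ := exists_of_isPartialSteiner hr hd hnm hmd hSt hne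
  refine ⟨H, hH, ?_⟩
  have hd0 : (0 : ℝ) < d := by exact_mod_cast hd
  set y : ℝ := (n : ℝ) / d with hy
  have hmy : (m : ℝ) ≤ y := by
    rw [hy, le_div_iff₀ hd0]; exact_mod_cast hmd.le
  have hy2 : 2 ≤ y := by
    refine le_trans ?_ hmy
    exact_mod_cast hr.trans hrm
  have hm2 : ((m + 1 : ℕ) : ℝ) ≤ 2 * y := by push_cast; linarith
  have hm1 : (1 : ℝ) ≤ ((m + 1 : ℕ) : ℝ) := by push_cast; linarith [Nat.cast_nonneg (α := ℝ) m]
  have hlogy : 0 ≤ Real.log y := Real.log_nonneg (by linarith)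
  have hlog : Real.log ((m + 1 : ℕ) : ℝ) ≤ 2 * Real.log y := by
    refine (Real.log_le_log (by linarith) hm2).trans ?_
    rw [Real.log_mul (by norm_num) (by linarith), two_mul]
    exact add_le_add_left (Real.log_le_log (by norm_num) hy2) _
  have hlog0 : 0 ≤ Real.log ((m + 1 : ℕ) : ℝ) := Real.log_nonneg hm1
  have h4 : ((m + 1 : ℕ) : ℝ) * Real.log ((m + 1 : ℕ) : ℝ) ≤ 4 * (y * Real.log y) := by
    calc _ ≤ (2 * y) * (2 * Real.log y) := mul_le_mul hm2 hlog hlog0 (by linarith)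
      _ = _ := by ring
  calc (H.indepNum : ℝ) ≤ r * S.indepNum := by exact_mod_cast hHα
    _ ≤ r * (a * (4 * (y * Real.log y) ^ (1 / (r : ℝ)))) := by
        refine mul_le_mul_of_nonneg_left (hα.trans (mul_le_mul_of_nonneg_left ?_ ha.le)) hr0.le
        refine (Real.rpow_le_rpow (by positivity) h4 (by positivity)).trans ?_
        exact rpow_one_div_mul_le (by omega) (by norm_num) (by positivity)
    _ = _ := by ring

/-! ### Tail bounds for the random hypergraph -/

section Random

theorem ofSet_coe_edges {n k : ℕ} {G : Finset (Finset (Fin n))}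
    (hG : G ⊆ Finset.univ.powersetCard k) :
    (ofSet k (G : Set (Finset (Fin n)))).edges = G := by
  ext e
  simp only [ofSet, Finset.mem_filter, Finset.mem_univ, true_and, Finset.mem_coe]
  exact ⟨fun h => h.2, fun h => ⟨(Finset.mem_powersetCard.1 (hG h)).2, h⟩⟩

theorem coe_edgeProb {n r d : ℕ} (hd : 1 ≤ d) (hn : d + r ≤ n) :
    (edgeProb n r d : ℝ) = (d : ℝ) / ((n : ℝ) - r) := by
  have h1 : (d : ℝ) + r ≤ n := by exact_mod_cast hn
  have h2 : (1 : ℝ) ≤ d := by exact_mod_cast hd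
  rw [edgeProb, Set.projIcc_of_mem]
  exact ⟨div_nonneg (by linarith) (by linarith), (div_le_one (by linarith)).2 (by linarith)⟩

theorem randomProb_le_one (n k : ℕ) (p : unitInterval) (A : KGraph k (Fin n) → Prop) :
    randomProb n k p A ≤ 1 := MeasureTheory.measureReal_le_one

theorem randomProb_mono {n k : ℕ} {p : unitInterval} {A B : KGraph k (Fin n) → Prop}
    (h : ∀ H, A H → B H) : randomProb n k p A ≤ randomProb n k p B :=
  MeasureTheory.measureReal_mono fun _ hE => h _ hE

theorem exists_of_randomProb_pos {n k : ℕ} {p : unitInterval} {A : KGraph k (Fin n) → Prop}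
    (h : 0 < randomProb n k p A) : ∃ H, A H := by
  by_contra! hcon
  simp [randomProb, hcon] at h

/-- With edge probability `d/(n-r)` this makes the mean degree exactly `d`. -/
theorem card_filter_subset {n r : ℕ} {R : Finset (Fin n)} (hR : R.card = r) :
    ((Finset.univ.powersetCard (r + 1)).filter fun e => R ⊆ e).card = n - r := by
  have : (Finset.univ.powersetCard (r + 1)).filter (fun e => R ⊆ e)
      = Rᶜ.image fun v => insert v R := by
    ext e
    simp only [Finset.mem_filter, Finset.mem_powersetCard, Finset.subset_univ, true_and,
      Finset.mem_image, Finset.mem_compl]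
    constructor
    · rintro ⟨hc, hs⟩
      obtain ⟨v, hv⟩ := Finset.card_eq_one.1
        (show (e \ R).card = 1 by rw [Finset.card_sdiff_of_subset hs]; omega)
      have hv' : v ∈ e \ R := hv ▸ Finset.mem_singleton_self v
      refine ⟨v, (Finset.mem_sdiff.1 hv').2, ?_⟩
      rw [Finset.insert_eq, ← hv, Finset.sdiff_union_of_subset hs]
    · rintro ⟨v, hv, rfl⟩
      exact ⟨by rw [Finset.card_insert_of_notMem hv, hR], Finset.subset_insert _ _⟩
  rw [this, Finset.card_image_of_injOn, Finset.card_compl, Fintype.card_fin, hR]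
  intro v hv w hw hvw
  have hvR : v ∉ R := by simpa using hv
  have : v ∈ insert w R := by
    rw [← show insert v R = insert w R from hvw]; exact Finset.mem_insert_self _ _
  exact (Finset.mem_insert.1 this).resolve_right hvR

/-- A bound on the probability that some degree is far from its mean. -/
theorem bernProb_degree_le {n r d : ℕ} (hd : 1 ≤ d) (hn : d + r ≤ n) {δ : ℝ} (hδ : 0 < δ)
    (hδ1 : δ ≤ 1) :
    bernProb ((Finset.univ : Finset (Fin n)).powersetCard (r + 1)) (edgeProb n r d)
      {G | ∃ R ∈ (Finset.univ : Finset (Fin n)).powersetCard r,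
        δ * d < |((ofSet (r + 1) (G : Set (Finset (Fin n)))).degree R : ℝ) - d|}
      ≤ 2 * Real.exp (r * Real.log n - δ ^ 2 / 4 * d) := by
  have h1 : (d : ℝ) + r ≤ n := by exact_mod_cast hn
  have h2 : (1 : ℝ) ≤ d := by exact_mod_cast hd
  have hr0 : (0 : ℝ) ≤ r := Nat.cast_nonneg r
  have hp0 : 0 ≤ (edgeProb n r d : ℝ) := (edgeProb n r d).2.1
  have hp1 : (edgeProb n r d : ℝ) ≤ 1 := (edgeProb n r d).2.2
  have hone : ∀ R ∈ (Finset.univ : Finset (Fin n)).powersetCard r,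
      bernProb ((Finset.univ : Finset (Fin n)).powersetCard (r + 1)) (edgeProb n r d)
        {G | δ * d < |((ofSet (r + 1) (G : Set (Finset (Fin n)))).degree R : ℝ) - d|}
        ≤ 2 * Real.exp (-(δ ^ 2 / 4 * d)) := by
    intro R hR
    have hRc := (Finset.mem_powersetCard.1 hR).2
    set s := ((Finset.univ : Finset (Fin n)).powersetCard (r + 1)).filter fun e => R ⊆ e with hs
    have hmean : (edgeProb n r d : ℝ) * s.card = d := by
      rw [coe_edgeProb hd hn, hs, card_filter_subset hRc, Nat.cast_sub (by omega)]
      exact div_mul_cancel₀ _ (by linarith)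
    have := bernProb_chernoff hp0 hp1 (Finset.filter_subset _ _ : s ⊆ _) hδ hδ1
    rw [hmean] at this
    refine le_trans (bernProb_mono hp0 hp1 fun G hG h => ?_) this
    have hdeg : (ofSet (r + 1) (G : Set (Finset (Fin n)))).degree R = (G ∩ s).card := by
      rw [degree, ofSet_coe_edges hG]
      congr 1
      ext e
      simp only [hs, Finset.mem_filter, Finset.mem_inter]
      exact ⟨fun h => ⟨h.1, hG h.1, h.2⟩, fun h => ⟨h.1, h.2.2⟩⟩
    simpa [hdeg] using h
  refine (bernProb_exists_le hp0 hp1 _ _).trans ((Finset.sum_le_sum hone).trans ?_)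
  rw [Finset.sum_const, Finset.card_powersetCard, Finset.card_univ, Fintype.card_fin, nsmul_eq_mul,
    sub_eq_add_neg, Real.exp_add, Real.exp_nat_mul, Real.exp_log (by linarith)]
  have : (n.choose r : ℝ) ≤ (n : ℝ) ^ r := by exact_mod_cast Nat.choose_le_pow n r
  have := mul_le_mul_of_nonneg_right this (Real.exp_pos (-(δ ^ 2 / 4 * d))).le
  linarith

/-- The first moment bound on the probability of having an independent set of size `k`. -/
theorem bernProb_indep_le {n r k : ℕ} (hn : 1 ≤ n) {p : ℝ} (hp0 : 0 ≤ p) (hp1 : p ≤ 1) :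
    bernProb ((Finset.univ : Finset (Fin n)).powersetCard (r + 1)) p
      {G | k ≤ (ofSet (r + 1) (G : Set (Finset (Fin n)))).indepNum}
      ≤ Real.exp (k * Real.log n - p * k.choose (r + 1)) := by
  have hsub : ∀ K : Finset (Fin n),
      K.powersetCard (r + 1) ⊆ (Finset.univ : Finset (Fin n)).powersetCard (r + 1) :=
    fun K => Finset.powersetCard_mono (Finset.subset_univ _)
  have h1 : bernProb ((Finset.univ : Finset (Fin n)).powersetCard (r + 1)) p
      {G | k ≤ (ofSet (r + 1) (G : Set (Finset (Fin n)))).indepNum}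
      ≤ ∑ K ∈ (Finset.univ : Finset (Fin n)).powersetCard k,
        bernProb ((Finset.univ : Finset (Fin n)).powersetCard (r + 1)) p
          {G | Disjoint G (K.powersetCard (r + 1))} := by
    refine le_trans (bernProb_mono hp0 hp1 fun G hG h => ?_) (bernProb_exists_le hp0 hp1 _ _)
    obtain ⟨K, hK, hKc⟩ := exists_isIndep_of_le_indepNum _ h
    refine ⟨K, by simp [hKc], Finset.disjoint_left.2 fun e he heK => ?_⟩
    refine hK e ?_ (Finset.mem_powersetCard.1 heK).1
    rwa [ofSet_coe_edges hG]
  refine h1.trans ?_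
  have h2 : ∀ K ∈ (Finset.univ : Finset (Fin n)).powersetCard k,
      bernProb ((Finset.univ : Finset (Fin n)).powersetCard (r + 1)) p
        {G | Disjoint G (K.powersetCard (r + 1))} ≤ Real.exp (-(p * k.choose (r + 1))) := by
    intro K hK
    rw [bernProb_disjoint (hsub K), Finset.card_powersetCard, (Finset.mem_powersetCard.1 hK).2]
    have h3 : 1 - p ≤ Real.exp (-p) := by
      have := Real.add_one_le_exp (-p); linarith
    refine (pow_le_pow_left₀ (by linarith) h3 _).trans ?_
    rw [← Real.exp_nat_mul]
    exact le_of_eq (congrArg _ (by ring))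
  refine (Finset.sum_le_sum h2).trans ?_
  rw [Finset.sum_const, Finset.card_powersetCard, Finset.card_univ, Fintype.card_fin, nsmul_eq_mul,
    sub_eq_add_neg, Real.exp_add, Real.exp_nat_mul, Real.exp_log (by exact_mod_cast hn)]
  refine mul_le_mul_of_nonneg_right ?_ (Real.exp_pos _).le
  exact_mod_cast Nat.choose_le_pow n k

/-- The exponent in the first moment bound. -/
theorem mul_log_le_mul_choose {r k : ℕ} (hr : 1 ≤ r) {ε L q : ℝ} (hε : 0 < ε) (hL : 0 ≤ L)
    (hq : 0 < q) (hk : 2 * (r + 1) * r * (1 + ε) / ε ≤ k)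
    (hkx : (1 + ε) * ((r + 1).factorial : ℝ) ^ (1 / (r : ℝ)) * (L / q) ^ (1 / (r : ℝ)) ≤ k) :
    (1 + ε / 2) * (k * L) ≤ q * k.choose (r + 1) := by
  have hr0 : (0 : ℝ) < r := by exact_mod_cast hr
  have hfac : (0 : ℝ) < (r + 1).factorial := by exact_mod_cast Nat.factorial_pos _
  have hk' : 2 * (r + 1) * r * (1 + ε) ≤ k * ε := (div_le_iff₀ hε).1 hk
  have hk0 : (0 : ℝ) < k := lt_of_lt_of_le (by positivity) hk
  -- Each factor of the falling factorial is at least `(1-δ) k`, so passing from `k^{r+1}/(r+1)!` to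
  -- the binomial coefficient loses at most a factor `1 - (r+1)δ`. The bound `hk` keeps this within
  -- half of the slack `ε`.
  set δ : ℝ := r / k with hδ
  have hδk : δ * k = r := div_mul_cancel₀ _ hk0.ne'
  have hδ1 : (r + 1) * δ * (1 + ε) ≤ ε / 2 := by
    rw [hδ, mul_div_assoc', div_mul_eq_mul_div, div_le_iff₀ hk0]
    linarith
  have hδ0 : 0 ≤ δ := by positivity
  have hδ2 : δ ≤ 1 := by
    have h1 : δ ≤ (r + 1) * δ := by nlinarith
    have h2 : (r + 1) * δ ≤ 1 := by
      by_contra! h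
      nlinarith
    linarith
  have hrk : r ≤ k := by
    have : (r : ℝ) ≤ k := by rw [← hδk]; nlinarith
    exact_mod_cast this
  have hpow : (1 + ε) ^ r * (r + 1).factorial * (L / q) ≤ (k : ℝ) ^ r := by
    have h1 := pow_le_pow_left₀ (by positivity) hkx r
    rwa [mul_pow, mul_pow, one_div, Real.rpow_inv_natCast_pow hfac.le (by omega),
      Real.rpow_inv_natCast_pow (by positivity) (by omega)] at h1
  have hch : (1 - (r + 1) * δ) * (k : ℝ) ^ (r + 1) ≤ (r + 1).factorial * k.choose (r + 1) := by
    have h1 := Nat.pow_le_choose (α := ℝ) (r + 1) k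
    rw [div_le_iff₀ hfac, Nat.add_sub_add_right, Nat.cast_sub hrk] at h1
    have h2 : (1 - δ) * k = (k : ℝ) - r := by linarith
    have h3 := one_add_mul_le_pow (a := -δ) (by linarith) (r + 1)
    push_cast at h3
    calc (1 - (r + 1) * δ) * (k : ℝ) ^ (r + 1) ≤ (1 - δ) ^ (r + 1) * (k : ℝ) ^ (r + 1) := by
          refine mul_le_mul_of_nonneg_right ?_ (by positivity)
          rw [← sub_eq_add_neg] at h3
          linarith
      _ = ((k : ℝ) - r) ^ (r + 1) := by rw [← mul_pow, h2]
      _ ≤ _ := by linarith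
  have hA : 1 + ε / 2 ≤ (1 - (r + 1) * δ) * (1 + ε) ^ r := by
    have h1 : 1 + ε ≤ (1 + ε) ^ r := le_self_pow₀ (by linarith) (by omega)
    have h2 : 0 ≤ 1 - (r + 1) * δ := by
      by_contra! h
      nlinarith
    have := mul_le_mul_of_nonneg_left h1 h2
    linarith
  have h2 : 0 ≤ 1 - (r + 1) * δ := by
    by_contra! h
    nlinarith
  have hfin : (r + 1).factorial * ((1 + ε / 2) * (k * L))
      ≤ (r + 1).factorial * (q * k.choose (r + 1)) := by
    calc (r + 1).factorial * ((1 + ε / 2) * (k * L))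
        ≤ (r + 1).factorial * ((1 - (r + 1) * δ) * (1 + ε) ^ r * (k * L)) := by
          refine mul_le_mul_of_nonneg_left ?_ hfac.le
          exact mul_le_mul_of_nonneg_right hA (by positivity)
      _ = q * ((1 - (r + 1) * δ) * ((1 + ε) ^ r * (r + 1).factorial * (L / q) * k)) := by
          field_simp
      _ ≤ q * ((1 - (r + 1) * δ) * ((k : ℝ) ^ r * k)) := by
          refine mul_le_mul_of_nonneg_left (mul_le_mul_of_nonneg_left ?_ h2) hq.le
          exact mul_le_mul_of_nonneg_right hpow hk0.le
      _ ≤ q * ((r + 1).factorial * k.choose (r + 1)) := by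
          rw [← pow_succ]
          exact mul_le_mul_of_nonneg_left hch hq.le
      _ = _ := by ring
  exact le_of_mul_le_mul_left hfin hfac

end Random

end KGraph

/-! ### Asymptotics of the random hypergraph and the sharp constant -/

namespace KGraph

theorem tendsto_log_natCast_atTop : Tendsto (fun n : ℕ => Real.log n) atTop atTop :=
  Real.tendsto_log_atTop.comp tendsto_natCast_atTop_atTop

theorem tendsto_of_log_isLittleO {d : ℕ → ℕ}
    (hd : (fun n : ℕ => Real.log n) =o[atTop] (fun n : ℕ => (d n : ℝ))) :
    Tendsto (fun n => (d n : ℝ)) atTop atTop := by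
  refine tendsto_atTop_mono' _ ?_ tendsto_log_natCast_atTop
  filter_upwards [hd.bound one_pos] with n hn
  rw [Real.norm_natCast, one_mul] at hn
  exact (le_abs_self _).trans hn

theorem tendsto_exp_neg_mul_log {c : ℝ} (hc : 0 < c) :
    Tendsto (fun n : ℕ => Real.exp (-(c * Real.log n))) atTop (𝓝 0) :=
  Real.tendsto_exp_neg_atTop_nhds_zero.comp (tendsto_log_natCast_atTop.const_mul_atTop hc)

/-- Degrees and independence number of the random hypergraph when `log n ≪ d`. -/
theorem tendsto_randomProb {r : ℕ} (hr : 2 ≤ r) {d : ℕ → ℕ}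
    (hd : (fun n : ℕ => Real.log n) =o[atTop] (fun n : ℕ => (d n : ℝ)))
    (hdn : ∀ᶠ n : ℕ in atTop, d n + r ≤ n) {ε : ℝ} (hε : 0 < ε) :
    Tendsto (fun n : ℕ => randomProb n (r + 1) (edgeProb n r (d n))
      (fun H =>
        (∀ R : Finset (Fin n), R.card = r → |(H.degree R : ℝ) - d n| ≤ ε * d n) ∧
        (H.indepNum : ℝ) ≤ (1 + ε) * ((r + 1).factorial : ℝ) ^ (1 / (r : ℝ)) *
          ((n : ℝ) / d n * Real.log n) ^ (1 / (r : ℝ)))) atTop (𝓝 1) := by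
  -- Chernoff's bound is available only for deviations `δ ≤ 1`.
  set δ := min ε 1 with hδ
  have hδ0 : 0 < δ := lt_min hε one_pos
  have hδ1 : δ ≤ 1 := min_le_right _ _
  have hr0 : (0 : ℝ) < r := by exact_mod_cast (by omega : 0 < r)
  have hfac : (1 : ℝ) ≤ ((r + 1).factorial : ℝ) := by
    exact_mod_cast Nat.one_le_iff_ne_zero.2 (Nat.factorial_ne_zero _)
  have hlim : Tendsto (fun n : ℕ => 1 - (2 * Real.exp (-(1 * Real.log n)) +
      Real.exp (-(ε / 2 * Real.log n)))) atTop (𝓝 1) := by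
    have := ((tendsto_exp_neg_mul_log one_pos).const_mul 2).add
      (tendsto_exp_neg_mul_log (half_pos hε))
    simpa using this.const_sub 1
  refine tendsto_of_tendsto_of_tendsto_of_le_of_le' hlim tendsto_const_nhds ?_
    (Eventually.of_forall fun n => randomProb_le_one _ _ _ _)
  have hrpow : Tendsto (fun n : ℕ => Real.log n ^ (1 / (r : ℝ))) atTop atTop :=
    (tendsto_rpow_atTop (by positivity)).comp tendsto_log_natCast_atTop
  filter_upwards [hdn, (tendsto_of_log_isLittleO hd).eventually_ge_atTop 1,
    hd.bound (show 0 < δ ^ 2 / (4 * (r + 1)) by positivity), eventually_ge_atTop 3,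
    hrpow.eventually_ge_atTop (2 * (r + 1) * r * (1 + ε) / ε)] with n hn hd1 hdlog hn3 hbig
  have hd1' : 1 ≤ d n := by exact_mod_cast hd1
  have hnr : (d n : ℝ) + r ≤ n := by exact_mod_cast hn
  have hlog0 : 0 ≤ Real.log n := Real.log_natCast_nonneg n
  have hdlog' : (r + 1) * Real.log n ≤ δ ^ 2 / 4 * d n := by
    rw [Real.norm_natCast, Real.norm_of_nonneg hlog0] at hdlog
    calc (r + 1) * Real.log n ≤ (r + 1) * (δ ^ 2 / (4 * (r + 1)) * d n) :=
          mul_le_mul_of_nonneg_left hdlog (by positivity)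
      _ = _ := by field_simp
  set p : ℝ := (edgeProb n r (d n) : ℝ) with hp
  have hp0 : 0 ≤ p := (edgeProb n r (d n)).2.1
  have hp1 : p ≤ 1 := (edgeProb n r (d n)).2.2
  have hpq : (d n : ℝ) / n ≤ p := by
    rw [hp, coe_edgeProb hd1' hn]
    exact div_le_div_of_nonneg_left (by linarith) (by linarith) (by linarith)
  have hn0 : (0 : ℝ) < n := by linarith
  have hd0 : (0 : ℝ) < d n := by linarith
  set x : ℝ := (1 + ε) * ((r + 1).factorial : ℝ) ^ (1 / (r : ℝ)) *
    ((n : ℝ) / d n * Real.log n) ^ (1 / (r : ℝ)) with hx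
  have hx0 : 0 ≤ x := by positivity
  set k := ⌊x⌋₊ + 1 with hk
  have hxk : x ≤ k := by
    rw [hk]; push_cast; exact (Nat.lt_floor_add_one x).le
  -- Since `d ≤ n`, this forces `k → ∞`, as the exponent estimate requires.
  have hlx : Real.log n ^ (1 / (r : ℝ)) ≤ x := by
    have h1 : Real.log n ^ (1 / (r : ℝ)) ≤ ((n : ℝ) / d n * Real.log n) ^ (1 / (r : ℝ)) := by
      refine Real.rpow_le_rpow hlog0 ?_ (by positivity)
      refine le_mul_of_one_le_left hlog0 ?_
      rw [one_le_div hd0]; linarith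
    have h2 : 1 ≤ (1 + ε) * ((r + 1).factorial : ℝ) ^ (1 / (r : ℝ)) := by
      have := Real.one_le_rpow hfac (show 0 ≤ 1 / (r : ℝ) by positivity)
      nlinarith
    exact h1.trans (le_mul_of_one_le_left (by positivity) h2)
  have hind := bernProb_indep_le (n := n) (r := r) (k := k) (by omega) hp0 hp1
  have hdeg := bernProb_degree_le (n := n) (r := r) hd1' hn hδ0 hδ1
  have hq : 0 < (d n : ℝ) / n := by positivity
  have hexp := mul_log_le_mul_choose (r := r) (k := k) (by omega) hε hlog0 hq
    ((hbig.trans hlx).trans hxk) (by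
      refine le_trans (le_of_eq ?_) hxk
      rw [hx]
      congr 2
      field_simp)
  have hind' : Real.exp (k * Real.log n - p * k.choose (r + 1))
      ≤ Real.exp (-(ε / 2 * Real.log n)) := by
    rw [Real.exp_le_exp]
    have h1 := mul_le_mul_of_nonneg_right hpq (Nat.cast_nonneg (α := ℝ) (k.choose (r + 1)))
    have h2 : Real.log n ≤ k * Real.log n := by
      refine le_mul_of_one_le_left hlog0 ?_
      rw [hk]; push_cast; linarith [Nat.cast_nonneg (α := ℝ) ⌊x⌋₊]
    nlinarith
  have hdeg' : Real.exp (r * Real.log n - δ ^ 2 / 4 * d n) ≤ Real.exp (-(1 * Real.log n)) := by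
    rw [Real.exp_le_exp]; linarith
  rw [randomProb_eq_bernProb, ← compl_compl {G : Finset (Finset (Fin n)) | _}, bernProb_compl]
  refine sub_le_sub_left ?_ 1
  have hu := bernProb_union_le (U := (Finset.univ : Finset (Fin n)).powersetCard (r + 1)) hp0 hp1
    {G | ∃ R ∈ (Finset.univ : Finset (Fin n)).powersetCard r,
        δ * d n < |((ofSet (r + 1) (G : Set (Finset (Fin n)))).degree R : ℝ) - d n|}
    {G | k ≤ (ofSet (r + 1) (G : Set (Finset (Fin n)))).indepNum}
  refine le_trans (bernProb_mono hp0 hp1 fun G _ hG => ?_) (hu.trans (by linarith))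
  by_contra hcon
  refine hG ?_
  simp only [Set.mem_union, Set.mem_ofPred_eq, not_or, not_exists, not_and, not_lt, not_le] at hcon
  refine ⟨fun R hR => ?_, ?_⟩
  · refine (hcon.1 R (by simp [hR])).trans ?_
    exact mul_le_mul_of_nonneg_right (min_le_left _ _) hd0.le
  · exact (Nat.le_floor_iff hx0).1 (Nat.lt_succ_iff.1 hcon.2)

/-- If `log d ≪ log n`, then `c log n ≤ log (n / d)` eventually, for every `c < 1`. -/
theorem eventually_of_log_isLittleO_log {d : ℕ → ℕ}
    (hd : (fun n : ℕ => Real.log n) =o[atTop] (fun n : ℕ => (d n : ℝ)))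
    (hdl : (fun n : ℕ => Real.log (d n)) =o[atTop] (fun n : ℕ => Real.log n))
    {c : ℝ} (hc : c < 1) :
    ∀ᶠ n : ℕ in atTop, c * Real.log n ≤ Real.log ((n : ℝ) / d n) := by
  filter_upwards [hdl.bound (sub_pos.2 hc), (tendsto_of_log_isLittleO hd).eventually_ge_atTop 1,
    eventually_ge_atTop 1] with n hn hd1 hn1
  have hn1' : (1 : ℝ) ≤ n := by exact_mod_cast hn1
  rw [Real.log_div (by linarith) (by linarith)]
  rw [Real.norm_of_nonneg (Real.log_natCast_nonneg n)] at hn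
  have := (le_abs_self _).trans hn
  linarith

/-- Eventually `n/d ≥ √n ≥ r + 1`, so `n ≥ (r+1) d ≥ d + r`. -/
theorem eventually_add_le {d : ℕ → ℕ} (r : ℕ)
    (hd : (fun n : ℕ => Real.log n) =o[atTop] (fun n : ℕ => (d n : ℝ)))
    (hdl : (fun n : ℕ => Real.log (d n)) =o[atTop] (fun n : ℕ => Real.log n)) :
    ∀ᶠ n : ℕ in atTop, d n + r ≤ n := by
  have h2 := tendsto_log_natCast_atTop.eventually_ge_atTop (2 * Real.log (r + 1))
  filter_upwards [eventually_of_log_isLittleO_log hd hdl (show (1 / 2 : ℝ) < 1 by norm_num), h2,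
    (tendsto_of_log_isLittleO hd).eventually_ge_atTop 1, eventually_ge_atTop 1] with n h1 h2 hd1 hn1
  have hn0 : (0 : ℝ) < n := by exact_mod_cast hn1
  have hr0 : (0 : ℝ) ≤ r := Nat.cast_nonneg r
  have h3 : Real.log (r + 1) ≤ Real.log ((n : ℝ) / d n) := by linarith
  rw [Real.log_le_log_iff (by linarith) (by positivity), le_div_iff₀ (by linarith)] at h3
  have h4 : (d n : ℝ) + r ≤ n := by nlinarith
  exact_mod_cast h4

theorem tendsto_randomProb_of_log_isLittleO {r : ℕ} (hr : 2 ≤ r) {d : ℕ → ℕ}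
    (hd : (fun n : ℕ => Real.log n) =o[atTop] (fun n : ℕ => (d n : ℝ)))
    (hdl : (fun n : ℕ => Real.log (d n)) =o[atTop] (fun n : ℕ => Real.log n))
    {ε : ℝ} (hε : 0 < ε) :
    Tendsto (fun n : ℕ => randomProb n (r + 1) (edgeProb n r (d n))
      (fun H =>
        (∀ R : Finset (Fin n), R.card = r → |(H.degree R : ℝ) - d n| ≤ ε * d n) ∧
        (H.indepNum : ℝ) ≤ (1 + ε) * ((r + 1).factorial : ℝ) ^ (1 / (r : ℝ)) *
          ((n : ℝ) / d n * Real.log ((n : ℝ) / d n)) ^ (1 / (r : ℝ)))) atTop (𝓝 1) := by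
  refine tendsto_of_tendsto_of_tendsto_of_le_of_le'
    (tendsto_randomProb hr hd (eventually_add_le r hd hdl) (half_pos hε)) tendsto_const_nhds ?_
    (Eventually.of_forall fun n => randomProb_le_one _ _ _ _)
  -- Chosen so that, after the `r`-th root, replacing `log n` by `log (n/d)` costs exactly the gap
  -- between `1 + ε/2` and `1 + ε`.
  have hc : ((1 + ε / 2) / (1 + ε)) ^ r < 1 :=
    pow_lt_one₀ (by positivity) ((div_lt_one (by linarith)).2 (by linarith)) (by omega)
  filter_upwards [eventually_of_log_isLittleO_log hd hdl hc] with n hn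
  refine randomProb_mono fun H hH => ⟨fun R hR => (hH.1 R hR).trans ?_, hH.2.trans ?_⟩
  · exact mul_le_mul_of_nonneg_right (by linarith) (Nat.cast_nonneg _)
  · have hlog0 : 0 ≤ Real.log n := Real.log_natCast_nonneg n
    have h1 : (1 + ε / 2) / (1 + ε) * ((n : ℝ) / d n * Real.log n) ^ (1 / (r : ℝ)) ≤
        ((n : ℝ) / d n * Real.log ((n : ℝ) / d n)) ^ (1 / (r : ℝ)) := by
      have h2 : (1 + ε / 2) / (1 + ε) = (((1 + ε / 2) / (1 + ε)) ^ r) ^ (1 / (r : ℝ)) := by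
        rw [one_div, Real.pow_rpow_inv_natCast (by positivity) (by omega)]
      rw [h2, ← Real.mul_rpow (by positivity) (by positivity)]
      refine Real.rpow_le_rpow (by positivity) ?_ (by positivity)
      calc _ = (n : ℝ) / d n * (((1 + ε / 2) / (1 + ε)) ^ r * Real.log n) := by ring
        _ ≤ _ := mul_le_mul_of_nonneg_left hn (by positivity)
    calc (1 + ε / 2) * ((r + 1).factorial : ℝ) ^ (1 / (r : ℝ)) *
          ((n : ℝ) / d n * Real.log n) ^ (1 / (r : ℝ))
        = (1 + ε) * ((r + 1).factorial : ℝ) ^ (1 / (r : ℝ)) *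
          ((1 + ε / 2) / (1 + ε) * ((n : ℝ) / d n * Real.log n) ^ (1 / (r : ℝ))) := by
          field_simp
      _ ≤ _ := mul_le_mul_of_nonneg_left h1 (by positivity)

/-- Examples with maximum degree exactly `d` and nearly optimal independence number. -/
theorem eventually_exists_maxDegree_eq {r : ℕ} (hr : 2 ≤ r) {d : ℕ → ℕ}
    (hd : (fun n : ℕ => Real.log n) =o[atTop] (fun n : ℕ => (d n : ℝ)))
    (hdl : (fun n : ℕ => Real.log (d n)) =o[atTop] (fun n : ℕ => Real.log n))
    {ε : ℝ} (hε : 0 < ε) :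
    ∀ᶠ n : ℕ in atTop, ∃ H : KGraph (r + 1) (Fin n), H.maxDegree = d n ∧
      (H.indepNum : ℝ) ≤ (1 + ε) * ((r + 1).factorial : ℝ) ^ (1 / (r : ℝ)) *
        ((n : ℝ) / d n * Real.log ((n : ℝ) / d n)) ^ (1 / (r : ℝ)) := by
  -- For `γ ≤ 1`, `(1+γ)^4 ≤ 1 + 15γ`. Of the four factors, one comes from the random bound, two
  -- from `d/d'` and one from `log n / log (n/d)`.
  set γ : ℝ := min 1 ε / 15 with hγ
  have hγ0 : 0 < γ := by positivity
  have hγ1 : γ ≤ 1 := by linarith [min_le_left 1 ε]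
  have hγε : (1 + γ) ^ 4 ≤ 1 + ε := by
    have : 15 * γ ≤ ε := by linarith [min_le_right 1 ε]
    have h2 : γ ^ 2 ≤ γ := by nlinarith
    have h3 : γ ^ 3 ≤ γ := by nlinarith
    have h4 : γ ^ 4 ≤ γ := by nlinarith
    nlinarith
  -- Degrees at most `(1+γ) d' ≤ d` leave room to add edges up to maximum degree exactly `d`.
  set d' : ℕ → ℕ := fun n => ⌊(d n : ℝ) / (1 + γ)⌋₊ with hd'
  have hdtop := tendsto_of_log_isLittleO hd
  have hup : ∀ n, (1 + γ) * (d' n : ℝ) ≤ d n := by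
    intro n
    have := Nat.floor_le (show 0 ≤ (d n : ℝ) / (1 + γ) by positivity)
    rw [le_div_iff₀ (by linarith)] at this
    rw [mul_comm]; exact this
  have hlo : ∀ᶠ n in atTop, (d n : ℝ) ≤ (1 + γ) ^ 2 * d' n := by
    filter_upwards [hdtop.eventually_ge_atTop ((1 + γ) ^ 2 / γ)] with n hn
    rw [div_le_iff₀ hγ0] at hn
    have h1 := (Nat.lt_floor_add_one ((d n : ℝ) / (1 + γ))).le
    rw [div_le_iff₀ (by linarith)] at h1
    have h2 : (d n : ℝ) ≤ (d' n + 1) * (1 + γ) := h1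
    have h3 := mul_le_mul_of_nonneg_right h2 (by linarith : 0 ≤ 1 + γ)
    nlinarith
  have hd'o : (fun n : ℕ => Real.log n) =o[atTop] (fun n : ℕ => (d' n : ℝ)) := by
    refine hd.trans_isBigO (IsBigO.of_bound ((1 + γ) ^ 2) ?_)
    filter_upwards [hlo] with n hn
    simpa using hn
  have hadd := eventually_add_le r hd hdl
  have hadd' : ∀ᶠ n in atTop, d' n + r ≤ n := by
    filter_upwards [hadd] with n hn
    have : (d' n : ℝ) ≤ d n := by nlinarith [hup n, Nat.cast_nonneg (α := ℝ) (d' n)]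
    have : d' n ≤ d n := by exact_mod_cast this
    omega
  have hprob := (tendsto_randomProb hr hd'o hadd' hγ0).eventually (lt_mem_nhds zero_lt_one)
  have hcl : (1 + γ)⁻¹ < 1 := inv_lt_one_of_one_lt₀ (by linarith)
  filter_upwards [hprob, hadd, hlo, eventually_of_log_isLittleO_log hd hdl hcl,
    hdtop.eventually_ge_atTop 1] with n hn hnd hnlo hnlog hd1
  obtain ⟨H, hdeg, hα⟩ := exists_of_randomProb_pos hn
  have hmax : H.maxDegree ≤ d n := by
    refine maxDegree_le_iff.2 fun R hR => ?_
    have h1 := (le_abs_self _).trans (hdeg R hR)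
    have h2 : (H.degree R : ℝ) ≤ d n := by linarith [hup n]
    exact_mod_cast h2
  obtain ⟨H', hsub, hH'⟩ := H.exists_maxDegree_eq hmax (by rwa [Fintype.card_fin])
  refine ⟨H', hH', ?_⟩
  have hlog0 : 0 ≤ Real.log n := Real.log_natCast_nonneg n
  have hd0 : (0 : ℝ) < d n := by linarith
  have hd'0 : (0 : ℝ) < d' n := by
    by_contra! h
    nlinarith [sq_nonneg (1 + γ)]
  have hlog1 : Real.log n ≤ (1 + γ) * Real.log ((n : ℝ) / d n) := by
    rwa [inv_mul_le_iff₀ (by linarith)] at hnlog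
  have hdiv : (n : ℝ) / d' n ≤ (1 + γ) ^ 2 * ((n : ℝ) / d n) := by
    rw [mul_div_assoc', div_le_div_iff₀ hd'0 hd0]
    nlinarith [Nat.cast_nonneg (α := ℝ) n]
  have hlogd : 0 ≤ Real.log ((n : ℝ) / d n) := by
    by_contra! h
    nlinarith
  have hX : (n : ℝ) / d' n * Real.log n
      ≤ (1 + γ) ^ 3 * ((n : ℝ) / d n * Real.log ((n : ℝ) / d n)) := by
    calc _ ≤ ((1 + γ) ^ 2 * ((n : ℝ) / d n)) * ((1 + γ) * Real.log ((n : ℝ) / d n)) :=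
          mul_le_mul hdiv hlog1 hlog0 (by positivity)
      _ = _ := by ring
  have hα' : (H'.indepNum : ℝ) ≤ H.indepNum := by exact_mod_cast indepNum_le_of_edges_subset hsub
  refine hα'.trans (hα.trans ?_)
  set F := ((r + 1).factorial : ℝ) ^ (1 / (r : ℝ)) with hF
  have hF0 : 0 ≤ F := by positivity
  calc (1 + γ) * F * ((n : ℝ) / d' n * Real.log n) ^ (1 / (r : ℝ))
      ≤ (1 + γ) * F * ((1 + γ) ^ 3 *
        ((n : ℝ) / d n * Real.log ((n : ℝ) / d n)) ^ (1 / (r : ℝ))) := by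
        refine mul_le_mul_of_nonneg_left ?_ (by positivity)
        refine (Real.rpow_le_rpow (by positivity) hX (by positivity)).trans ?_
        exact rpow_one_div_mul_le (by omega) (one_le_pow₀ (by linarith)) (by positivity)
    _ = (1 + γ) ^ 4 * (F * ((n : ℝ) / d n * Real.log ((n : ℝ) / d n)) ^ (1 / (r : ℝ))) := by ring
    _ ≤ (1 + ε) * (F * ((n : ℝ) / d n * Real.log ((n : ℝ) / d n)) ^ (1 / (r : ℝ))) :=
        mul_le_mul_of_nonneg_right hγε (by positivity)
    _ = _ := by ring

/-- No constant in the lower bound exceeds `(r+1)!^{1/r}`. -/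
theorem IsLowerBoundConstant.le {r : ℕ} (hr : 2 ≤ r) {c : ℝ} (hc : IsLowerBoundConstant r c) :
    c ≤ ((r + 1).factorial : ℝ) ^ (1 / (r : ℝ)) := by
  set F := ((r + 1).factorial : ℝ) ^ (1 / (r : ℝ)) with hF
  have hF0 : 0 < F := by positivity
  -- Large enough for `log n ≪ d`, yet polylogarithmic, so `log d ≪ log n` and `d < n / (log
  -- n)^{3r²}` hold as well.
  set d : ℕ → ℕ := fun n => ⌈Real.log n ^ 2⌉₊ with hd
  have hlow : ∀ n : ℕ, Real.log n ^ 2 ≤ d n := fun n => Nat.le_ceil _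
  have hupp : ∀ᶠ n : ℕ in atTop, (d n : ℝ) ≤ Real.log n ^ 3 := by
    filter_upwards [tendsto_log_natCast_atTop.eventually_ge_atTop 2] with n hn
    have := (Nat.ceil_lt_add_one (sq_nonneg (Real.log n))).le
    refine this.trans ?_
    nlinarith [sq_nonneg (Real.log n)]
  have hlogo : (fun n : ℕ => Real.log n) =o[atTop] (fun n : ℕ => (d n : ℝ)) := by
    have h1 : (fun x : ℝ => x) =o[atTop] (fun x : ℝ => x ^ 2) := by
      simpa using isLittleO_pow_pow_atTop_of_lt (𝕜 := ℝ) one_lt_two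
    refine (h1.comp_tendsto tendsto_log_natCast_atTop).trans_le fun n => ?_
    simp only [Function.comp_apply]
    rw [Real.norm_of_nonneg (sq_nonneg _), Real.norm_natCast]
    exact hlow n
  have hd1 := (tendsto_of_log_isLittleO hlogo).eventually_ge_atTop 1
  have hdo : (fun n : ℕ => Real.log (d n)) =o[atTop] (fun n : ℕ => Real.log n) := by
    have h1 : (fun n : ℕ => Real.log (Real.log n)) =o[atTop] (fun n : ℕ => Real.log n) :=
      Real.isLittleO_log_id_atTop.comp_tendsto tendsto_log_natCast_atTop
    refine IsBigO.trans_isLittleO (IsBigO.of_bound 3 ?_) h1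
    filter_upwards [hupp, hd1, tendsto_log_natCast_atTop.eventually_ge_atTop 1] with n h2 h3 h4
    rw [Real.norm_of_nonneg (Real.log_nonneg h3), Real.norm_of_nonneg (Real.log_nonneg h4)]
    refine (Real.log_le_log (by linarith) h2).trans ?_
    rw [Real.log_pow]
    norm_num
  have hsmall : ∀ᶠ n : ℕ in atTop, (d n : ℝ) < (n : ℝ) / Real.log n ^ (3 * r ^ 2) := by
    have h1 := ((Real.isLittleO_pow_log_id_atTop (n := 3 + 3 * r ^ 2)).comp_tendsto
      (tendsto_natCast_atTop_atTop (R := ℝ))).bound (show (0 : ℝ) < 1 / 2 by norm_num)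
    filter_upwards [h1, hupp, tendsto_log_natCast_atTop.eventually_ge_atTop 1,
      eventually_ge_atTop 1] with n h1 h2 h3 h4
    have hn0 : (0 : ℝ) < n := by exact_mod_cast h4
    have hl0 : 0 < Real.log n := by linarith
    simp only [Function.comp_apply, id, Real.norm_natCast] at h1
    rw [Real.norm_of_nonneg (by positivity), pow_add] at h1
    rw [lt_div_iff₀ (by positivity)]
    have := mul_le_mul_of_nonneg_right h2 (show 0 ≤ Real.log n ^ (3 * r ^ 2) by positivity)
    linarith
  refine le_of_forall_pos_le_add fun η hη => ?_
  -- With this `ε`, `(1 + ε) F = F + η`.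
  have hε : 0 < η / F := by positivity
  have hpos := eventually_of_log_isLittleO_log hlogo hdo (show (1 / 2 : ℝ) < 1 by norm_num)
  obtain ⟨n, hn, ⟨H, hH, hα⟩, hs, hp, hl, hdn, hn1⟩ :=
    (hc.and ((eventually_exists_maxDegree_eq hr hlogo hdo hε).and (hsmall.and (hpos.and
      ((tendsto_log_natCast_atTop.eventually_ge_atTop 1).and
        (hd1.and (eventually_ge_atTop 1))))))).exists
  have h1 := hn H (by rwa [hH])
  rw [hH] at h1
  have hn0 : (0 : ℝ) < n := by exact_mod_cast hn1
  have hX : 0 < ((n : ℝ) / d n * Real.log ((n : ℝ) / d n)) ^ (1 / (r : ℝ)) := by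
    have : 0 < Real.log ((n : ℝ) / d n) := by linarith
    have : (0 : ℝ) < d n := by linarith
    positivity
  have h2 := le_of_mul_le_mul_right (h1.trans hα) hX
  rw [← hF] at h2
  refine h2.trans (le_of_eq ?_)
  field_simp

end KGraph

/-! ### Stirling's formula and the main theorem -/

/-- The growth of `(r+1)!^{1/r}`, from Stirling's formula. -/
theorem factorial_rpow_isEquivalent :
    (fun r : ℕ => ((r + 1).factorial : ℝ) ^ (1 / (r : ℝ)))
      ~[atTop] (fun r : ℕ => (r : ℝ) / Real.exp 1) := by
  have hne : ∀ᶠ r : ℕ in atTop, (r : ℝ) / Real.exp 1 ≠ 0 := by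
    filter_upwards [eventually_ge_atTop 1] with r hr
    have : (0 : ℝ) < r := by exact_mod_cast hr
    positivity
  rw [isEquivalent_iff_tendsto_one hne]
  -- The ratio is squeezed between `1` and `r^{3/r}`, because `(r/e)^r ≤ (r+1)! ≤ r³ (r/e)^r` for `r
  -- ≥ 16`.
  have hlim : Tendsto (fun r : ℕ => (r : ℝ) ^ (3 / (r : ℝ))) atTop (𝓝 1) := by
    have := (tendsto_rpow_div_mul_add 3 1 0 zero_ne_one).comp
      (tendsto_natCast_atTop_atTop (R := ℝ))
    refine this.congr fun r => ?_
    simp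
  refine tendsto_of_tendsto_of_tendsto_of_le_of_le' tendsto_const_nhds hlim ?_ ?_
  all_goals
    filter_upwards [eventually_ge_atTop 16] with r hr
    have hr16 : (16 : ℝ) ≤ r := by exact_mod_cast hr
    have hr0 : (0 : ℝ) < r := by linarith
    have hE : (r : ℝ) / Real.exp 1 = (((r : ℝ) / Real.exp 1) ^ r) ^ (1 / (r : ℝ)) := by
      rw [one_div, Real.pow_rpow_inv_natCast (by positivity) (by omega)]
    have hEp : 0 < ((r : ℝ) / Real.exp 1) ^ r := by positivity
    have hfact : ((r + 1).factorial : ℝ) = (r + 1) * r.factorial := by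
      rw [Nat.factorial_succ]; push_cast; ring
    simp only [Pi.div_apply]
  · rw [one_le_div (by positivity), hE]
    refine Real.rpow_le_rpow hEp.le ?_ (by positivity)
    have h1 := Stirling.le_factorial_stirling r
    have h2 : 1 ≤ √(2 * Real.pi * r) := by
      rw [Real.one_le_sqrt]
      nlinarith [Real.pi_gt_three]
    rw [hfact]
    have h3 : ((r : ℝ) / Real.exp 1) ^ r ≤ r.factorial :=
      (le_mul_of_one_le_left hEp.le h2).trans h1
    exact h3.trans (le_mul_of_one_le_left (by positivity) (by linarith))
  · rw [div_le_iff₀ (by positivity)]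
    have h3 : (r : ℝ) ^ (3 / (r : ℝ)) = ((r : ℝ) ^ 3) ^ (1 / (r : ℝ)) := by
      rw [← Real.rpow_natCast, ← Real.rpow_mul hr0.le]
      congr 1
      push_cast
      ring
    rw [h3, hE, ← Real.mul_rpow (by positivity) hEp.le]
    refine Real.rpow_le_rpow (by positivity) ?_ (by positivity)
    -- The sequence decreases from its value `e/√2` at 1.
    have hs : Stirling.stirlingSeq r ≤ 2 := by
      have h1 := Stirling.stirlingSeq'_antitone (Nat.zero_le (r - 1))
      simp only [Function.comp_apply] at h1
      rw [Nat.succ_eq_add_one, Nat.sub_add_cancel (by omega), Nat.succ_eq_add_one, zero_add,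
        Stirling.stirlingSeq_one] at h1
      refine h1.trans ?_
      rw [div_le_iff₀ (by positivity)]
      have h2 : (1.4 : ℝ) ≤ √2 := Real.le_sqrt_of_sq_le (by norm_num)
      linarith [Real.exp_one_lt_d9]
    have hfs : (r.factorial : ℝ) =
        Stirling.stirlingSeq r * (√(2 * r) * ((r : ℝ) / Real.exp 1) ^ r) := by
      rw [Stirling.stirlingSeq, div_mul_cancel₀]
      positivity
    have hsq : √(2 * r) ≤ r := by
      rw [Real.sqrt_le_left hr0.le]
      nlinarith
    rw [hfact, hfs]
    have h5 : Stirling.stirlingSeq r * (√(2 * r) * ((r : ℝ) / Real.exp 1) ^ r)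
        ≤ 2 * (r * ((r : ℝ) / Real.exp 1) ^ r) :=
      mul_le_mul hs (mul_le_mul_of_nonneg_right hsq hEp.le) (by positivity) (by norm_num)
    calc _ ≤ ((r : ℝ) + 1) * (2 * (r * ((r : ℝ) / Real.exp 1) ^ r)) :=
          mul_le_mul_of_nonneg_left h5 (by linarith)
      _ = (2 * (r + 1) * r) * ((r : ℝ) / Real.exp 1) ^ r := by ring
      _ ≤ _ := by
          refine mul_le_mul_of_nonneg_right ?_ hEp.le
          rw [pow_succ]
          exact mul_le_mul_of_nonneg_right (by nlinarith) hr0.le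

theorem mainTheorem3 :
    (∀ r : ℕ, 2 ≤ r →
      -- blowups of partial Steiner systems: maximum degree and independence number
      (∀ (m : ℕ) (S : KGraph (r + 1) (Fin m)), S.IsPartialSteiner → S.edges.Nonempty →
        ∀ d : ℕ, 1 ≤ d →
          (S.blowup d).maxDegree = d ∧ (S.blowup d).indepNum = min r d * S.indepNum) ∧
      -- Steiner systems with small independence number, and their blowups (on `N = m d` vertices)
      (∃ a b : ℝ, 0 < a ∧ 0 < b ∧ ∀ m : ℕ, r + 1 ≤ m →
        ∃ S : KGraph (r + 1) (Fin m), S.IsPartialSteiner ∧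
          (S.indepNum : ℝ) ≤ a * ((m : ℝ) * Real.log m) ^ (1 / (r : ℝ)) ∧
          ∀ d N : ℕ, 1 ≤ d → N = m * d →
            (S.blowup d).maxDegree = d ∧
            ((S.blowup d).indepNum : ℝ)
              ≤ b * ((N : ℝ) / d * Real.log ((N : ℝ) / d)) ^ (1 / (r : ℝ))) ∧
      -- examples for every `d` and every number `n > r d` of vertices
      (∃ b : ℝ, 0 < b ∧ ∀ d n : ℕ, 1 ≤ d → r * d < n →
        ∃ H : KGraph (r + 1) (Fin n), H.maxDegree = d ∧
          (H.indepNum : ℝ)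
            ≤ b * ((n : ℝ) / d * Real.log ((n : ℝ) / d)) ^ (1 / (r : ℝ))) ∧
      -- the random hypergraph when `log n ≪ d`
      (∀ d : ℕ → ℕ, (fun n : ℕ => Real.log n) =o[atTop] (fun n : ℕ => (d n : ℝ)) →
        (∀ᶠ n : ℕ in atTop, d n + r ≤ n) →
        ∀ ε : ℝ, 0 < ε →
          Tendsto (fun n : ℕ => KGraph.randomProb n (r + 1) (KGraph.edgeProb n r (d n))
            (fun H =>
              (∀ R : Finset (Fin n), R.card = r → |(H.degree R : ℝ) - d n| ≤ ε * d n) ∧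
              (H.indepNum : ℝ) ≤ (1 + ε) * ((r + 1).factorial : ℝ) ^ (1 / (r : ℝ)) *
                ((n : ℝ) / d n * Real.log n) ^ (1 / (r : ℝ)))) atTop (𝓝 1)) ∧
      -- the random hypergraph when `log n ≪ d` and `log d ≪ log n`, and the resulting examples
      -- with maximum `r`-degree exactly `d`
      (∀ d : ℕ → ℕ, (fun n : ℕ => Real.log n) =o[atTop] (fun n : ℕ => (d n : ℝ)) →
        (fun n : ℕ => Real.log (d n)) =o[atTop] (fun n : ℕ => Real.log n) →
        ∀ ε : ℝ, 0 < ε →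
          Tendsto (fun n : ℕ => KGraph.randomProb n (r + 1) (KGraph.edgeProb n r (d n))
            (fun H =>
              (∀ R : Finset (Fin n), R.card = r → |(H.degree R : ℝ) - d n| ≤ ε * d n) ∧
              (H.indepNum : ℝ) ≤ (1 + ε) * ((r + 1).factorial : ℝ) ^ (1 / (r : ℝ)) *
                ((n : ℝ) / d n * Real.log ((n : ℝ) / d n)) ^ (1 / (r : ℝ)))) atTop (𝓝 1) ∧
          ∀ᶠ n : ℕ in atTop, ∃ H : KGraph (r + 1) (Fin n), H.maxDegree = d n ∧
            (H.indepNum : ℝ) ≤ (1 + ε) * ((r + 1).factorial : ℝ) ^ (1 / (r : ℝ)) *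
              ((n : ℝ) / d n * Real.log ((n : ℝ) / d n)) ^ (1 / (r : ℝ))) ∧
      -- no constant in the lower bound exceeds `(r+1)!^{1/r}`
      (∀ c : ℝ, KGraph.IsLowerBoundConstant r c →
        c ≤ ((r + 1).factorial : ℝ) ^ (1 / (r : ℝ)))) ∧
    -- `(r+1)!^{1/r} ∼ r/e`, so the constants in the lower bound are at most `(1 + o(1)) r/e`
    (fun r : ℕ => ((r + 1).factorial : ℝ) ^ (1 / (r : ℝ)))
      ~[atTop] (fun r : ℕ => (r : ℝ) / Real.exp 1) ∧
    (∀ c : ℕ → ℝ, (∀ r : ℕ, 2 ≤ r → KGraph.IsLowerBoundConstant r (c r)) →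
      ∀ ε : ℝ, 0 < ε → ∀ᶠ r : ℕ in atTop, c r ≤ (1 + ε) * ((r : ℝ) / Real.exp 1)) := by
  refine ⟨fun r hr => ⟨?_, ?_, ?_, ?_, ?_, ?_⟩, factorial_rpow_isEquivalent, ?_⟩
  · intro m S hS hne d hd
    exact ⟨KGraph.maxDegree_blowup hr hS hne hd, KGraph.indepNum_blowup S hd⟩
  · obtain ⟨a, ha, hS⟩ := KGraph.exists_isPartialSteiner_indepNum_le hr
    have hr0 : (0 : ℝ) < r := by exact_mod_cast (by omega : 0 < r)
    -- The factor `r` bounds `min(r, d)`, and `N/d = m`.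
    refine ⟨a, r * a, ha, by positivity, fun m hm => ?_⟩
    obtain ⟨S, hSt, hne, hα⟩ := hS m hm
    refine ⟨S, hSt, hα, fun d N hd hN => ⟨KGraph.maxDegree_blowup hr hSt hne hd, ?_⟩⟩
    have hd0 : (d : ℝ) ≠ 0 := by exact_mod_cast (by omega : d ≠ 0)
    have hNd : (N : ℝ) / d = m := by
      rw [hN, Nat.cast_mul, mul_div_cancel_right₀ _ hd0]
    rw [hNd, KGraph.indepNum_blowup S hd, Nat.cast_mul, mul_assoc]
    exact mul_le_mul (by exact_mod_cast min_le_left r d) hα (Nat.cast_nonneg _) hr0.le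
  · exact KGraph.exists_maxDegree_eq_indepNum_le hr
  · exact fun d hd hdn ε hε => KGraph.tendsto_randomProb hr hd hdn hε
  · exact fun d hd hdl ε hε => ⟨KGraph.tendsto_randomProb_of_log_isLittleO hr hd hdl hε,
      KGraph.eventually_exists_maxDegree_eq hr hd hdl hε⟩
  · exact fun c hc => hc.le hr
  · intro c hc ε hε
    have hne : ∀ᶠ r : ℕ in atTop, (r : ℝ) / Real.exp 1 ≠ 0 := by
      filter_upwards [eventually_ge_atTop 1] with r hr
      have : (0 : ℝ) < r := by exact_mod_cast hr
      positivity
    have hlim := (isEquivalent_iff_tendsto_one hne).1 factorial_rpow_isEquivalent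
    filter_upwards [hlim.eventually (gt_mem_nhds (by linarith : (1 : ℝ) < 1 + ε)),
      eventually_ge_atTop 2] with r h1 hr
    have hr0 : (0 : ℝ) < r := by exact_mod_cast (by omega : 0 < r)
    rw [Pi.div_apply, div_lt_iff₀ (by positivity)] at h1
    exact ((hc r hr).le hr).trans h1.le
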